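/- **Model.** Let $G=(V,E)$ be a finite connected graph with $n$ vertices and a designated start vertex $v_1$; an input is $X=(x_v)_{v\in V}\in\{0,1\}^V$, and $v$ is marked if $x_v=1$. A quantum robot on $G$ has a state $\sum\alpha_{v,z}|v,z\rangle$ with $v\in V$ and $z$ a (nonempty, arbitrarily long) bit string. It starts in $|v_1,0\rangle$ and applies $U^{(1)},O,U^{(2)},O,\dots,U^{(T)},O$. The oracle step is $O:|v,z\rangle\mapsto|v,z\oplus x_v\rangle$, with $x_v$ exclusive-OR'ed into the first bit of $z$. Each $U^{(t)}$ is a unitary, independent of $X$, that is C-local: the basis states can be partitioned into sets such that $U^{(t)}$ has entry $0$ between basis states of distinct sets, and all basis states in any one set come from the same vertex or from two adjacent vertices. For a partial Boolean function $f$ of $X$, $Q(f,G)$ is the least $T$ for which some robot, after $T$ algorithm steps and $T$ oracle steps, has for every $X$ in the domain of $f$ a designated output bit of $z$ equal to $f(X)$ with probability at least $2/3$. Let $\mathrm{OR}^{(\ge k)}$ be the problem of deciding whether there are no marked vertices or at least $k$ of them, given that one of these is true. A family of finite connected graphs is $d$-dimensional if there is $\kappa>0$ such that for every graph $G$ in the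 family, with $n$ vertices, every vertex $v$ of $G$ and every integer $\ell\ge 0$, $|B(v,\ell)|\ge\min(\kappa\ell^d,n)$, where $B(v,\ell)$ is the set of vertices at distance at most $\ell$ from $v$ in $G$. **Corollary.** Let $d>2$ be a real constant and let a $d$-dimensional family of graphs (with start vertices) be given. Then $$Q\left(\mathrm{OR}^{(\ge k)},G\right)=O\left(\frac{\sqrt n\,\operatorname{polylog}\frac nk}{k^{1/2-1/d}}\right),$$ that is, there are constants $C$ and $c$ such that for every graph $G$ in the family, with $n$ vertices, and all $1\le k\le n$, $$Q\left(\mathrm{OR}^{(\ge k)},G\right)\le C\,\frac{\sqrt n\,\left(1+\log\frac nk\right)^c}{k^{1/2-1/d}}.$$ -/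

import Mathlib

open scoped ENNReal Matrix

namespace SpatialSearch

/-- Internal configurations of a robot: bit strings. They may be arbitrarily long, but there is
always a first bit, the one with index `0`, which the oracle acts on. -/
abbrev Bits (w : ℕ) : Type := Fin (w + 1) → Bool

/-- The basis states `|v, z⟩`: a location `v` and an internal configuration `z`. -/
abbrev BasisState (V : Type*) (w : ℕ) := V × Bits w

/-- A pure state, given by its amplitudes. -/
abbrev State (V : Type*) (w : ℕ) := BasisState V w → ℂ

section Oracle

variable {V : Type*} {w : ℕ}

/-- `|v, z⟩ ↦ |v, z ⊕ x_v⟩`, where `x_v` is exclusive-or'ed into the first bit of `z`. -/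
def query (X : V → Bool) (b : BasisState V w) : BasisState V w :=
  (b.1, Function.update b.2 0 (xor (b.2 0) (X b.1)))

theorem query_query (X : V → Bool) (b : BasisState V w) : query X (query X b) = b := by
  simp [query]

/-- The oracle step, the linear extension of `query X` to states. As `query X` is an involution,
the amplitude of `b` after the step is the amplitude of `query X b` before it. -/
def oracle (X : V → Bool) (ψ : State V w) : State V w := fun b => ψ (query X b)

theorem oracle_single [DecidableEq V] (X : V → Bool) (b : BasisState V w) :
    oracle X (Pi.single b 1) = Pi.single (query X b) 1 := by
  funext b'
  have h : query X b' = b ↔ b' = query X b :=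
    ⟨fun h => by rw [← h, query_query], fun h => by rw [h, query_query]⟩
  simp only [oracle, Pi.single_apply, h]

end Oracle

/-- C-locality. The entry `U b' b` (row `b'`, column `b`) is the amplitude that `U` sends from the
basis state `b` to the basis state `b'`. The equivalence classes of `P` are the parts of the
partition of the basis states. -/
def IsCLocal {V : Type*} {w : ℕ} (G : SimpleGraph V)
    (U : Matrix (BasisState V w) (BasisState V w) ℂ) : Prop :=
  ∃ P : Setoid (BasisState V w),
    (∀ b b' : BasisState V w, ¬ P b b' → U b' b = 0) ∧
    (∀ S ∈ P.classes, ∃ u v : V, (u = v ∨ G.Adj u v) ∧ ∀ b ∈ S, b.1 = u ∨ b.1 = v)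

/-- A quantum robot on the graph `G`: the length `w + 1` of its internal register, the position of
its output bit, and its C-local unitary algorithm steps (none of which depends on the input).
A `T`-query computation uses the steps `0, …, T - 1` only. -/
structure Robot {V : Type*} [Fintype V] [DecidableEq V] (G : SimpleGraph V) where
  w : ℕ
  out : Fin (w + 1)
  step : ℕ → Matrix (BasisState V w) (BasisState V w) ℂ
  step_unitary : ∀ t, step t ∈ Matrix.unitaryGroup (BasisState V w) ℂ
  step_cLocal : ∀ t, IsCLocal G (step t)

section Complexity

variable {V : Type*} [Fintype V] [DecidableEq V] {G : SimpleGraph V}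

/-- The state of the robot on input `X` immediately after the `t`-th oracle step, when it starts
in `|s, 0⟩`. Each round is one algorithm step followed by one oracle step. -/
noncomputable def Robot.state (A : Robot G) (s : V) (X : V → Bool) : ℕ → State V A.w
  | 0 => Pi.single (s, fun _ => false) 1
  | t + 1 => oracle X (A.step t *ᵥ A.state s X t)

/-- The probability that the output bit equals `y` after `T` algorithm and `T` oracle steps. -/
noncomputable def Robot.outputProb (A : Robot G) (s : V) (X : V → Bool) (T : ℕ) (y : Bool) : ℝ :=
  ∑ b : BasisState V A.w with b.2 A.out = y, ‖A.state s X T b‖ ^ 2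

/-- The robot evaluates the partial Boolean function `f` (`none` means that the input violates the
promise) in `T` steps, with probability at least `2/3` on every input satisfying the promise. -/
def Robot.Evaluates (A : Robot G) (s : V) (f : (V → Bool) → Option Bool) (T : ℕ) : Prop :=
  ∀ (X : V → Bool) (y : Bool), f X = some y → 2 / 3 ≤ A.outputProb s X T y

/-- `Q(f, G)` for a robot starting at the vertex `s`: the least number `T` of steps in which a
quantum robot on `G` evaluates `f` (and `⊤` if there is none). -/
noncomputable def queryComplexity (G : SimpleGraph V) (s : V)
    (f : (V → Bool) → Option Bool) : ℕ∞ :=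
  ⨅ (T : ℕ) (_ : ∃ A : Robot G, A.Evaluates s f T), (T : ℕ∞)

end Complexity

/-- The number of marked vertices. -/
def markedCount {V : Type*} [Fintype V] (X : V → Bool) : ℕ :=
  (Finset.univ.filter fun v => X v = true).card

/-- `OR^(≥k)`: are there no marked vertices, or at least `k` of them, given that one of the two is
the case? -/
def orAtLeast {V : Type*} [Fintype V] (k : ℕ) (X : V → Bool) : Option Bool :=
  if markedCount X = 0 then some false
  else if k ≤ markedCount X then some true
  else none

/-- `B(v, ℓ)`: the vertices at distance at most `ℓ` from `v`. -/
def ball {V : Type*} (G : SimpleGraph V) (v : V) (l : ℕ) : Set V :=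
  {u | G.edist v u ≤ (l : ℕ∞)}

/-- A family of finite connected graphs is `d`-dimensional if for some `κ > 0`, all balls in all
graphs `G i` of the family satisfy `|B(v, ℓ)| ≥ min (κ ℓ^d, n)`, where `n` is the number of
vertices of `G i`. -/
def IsDimensional {ι : Type*} {V : ι → Type*} [∀ i, Fintype (V i)] (d : ℝ)
    (G : ∀ i, SimpleGraph (V i)) : Prop :=
  (∀ i, (G i).Connected) ∧
  ∃ κ : ℝ, 0 < κ ∧ ∀ (i : ι) (v : V i) (l : ℕ),
    min (κ * (l : ℝ) ^ d) (Fintype.card (V i) : ℝ) ≤ ((ball (G i) v l).ncard : ℝ)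

end SpatialSearch

/-! The robot runs a quantum walk on a tree that it simulates inside the graph. The leaves are the
vertices of `G`, the root sits at the start vertex, and every node lies with its children on one
vertex or one edge of `G`, so that the reflections at the nodes are C-local. Edges carry weights,
and a dangling edge of weight 1 is attached to the root. Let U be the product of the reflections at
the nodes of even and of odd height, with the reflections at marked leaves cancelled by a sign
query.

Electric networks govern U. With no marked vertex, the vector u of square roots of weights satisfies
u - Uu = 2δ, where δ is the dangling edge, so the averages of the iterates of δ have squared norm at
most W/(N+1)², where W is the total weight (`LayeredTree.two_smul_root`,
`average_sq_le_of_coboundary`). With marked vertices, a unit flow from the root to them yields a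
vector fixed by U with component 1 on δ, so the averages keep squared norm at least 1/R, where R is
the energy of the flow (`LayeredTree.walk_flowVec`, `le_average_sq_of_fixed`). The averages are
compared by a counter in uniform superposition (`phaseTest_prob`); hence if R ≤ 3/2, then O(√W)
steps suffice (`LayeredTree.queryComplexity_le`).

The tree has scales r2^j with r about k^(1/d). At scale j the nodes are the centres of a maximal
packing of balls, at most n/(κ(r2^j)^d) many. Below the first scale lie 8r layers without branching:
there the flow uniform on at least k leaves has energy 1/k per unit of resistance, so weight of
order r/k per edge is enough. In the q-th group of 8r layers, weight of order r·q^(d/2) makes both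
the energy and the total weight decay like q^(-d/2), which is summable because d > 2. The bottom
costs r²n/k and the rest r²n/r^d; these balance at r^d ≈ k, giving W of order n/k^(1-2/d). Since the
series converges and a single test decides, no logarithm appears. -/

namespace SpatialSearch

/-! ### Local circuits over an arbitrary finite set of located basis states -/

section Simulation

variable {V : Type*} {B : Type*}

/-- C-locality for matrices over a set `B` of basis states with locations `loc`. -/
def IsLocalOn (G : SimpleGraph V) (loc : B → V) (M : Matrix B B ℂ) : Prop :=
  ∃ P : Setoid B, (∀ b b' : B, ¬ P b b' → M b' b = 0) ∧
    ∀ b : B, ∃ u v : V, (u = v ∨ G.Adj u v) ∧ ∀ b', P b b' → loc b' = u ∨ loc b' = v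

theorem IsLocalOn.diagonal [DecidableEq B] (G : SimpleGraph V) (loc : B → V) (σ : B → ℂ) :
    IsLocalOn G loc (Matrix.diagonal σ) := by
  refine ⟨⊥, fun b b' h => Matrix.diagonal_apply_ne _ fun h' => h h'.symm, fun b => ?_⟩
  refine ⟨loc b, loc b, Or.inl rfl, fun b' h => ?_⟩
  have h' : b = b' := h
  simp [h']

/-- A matrix all of whose entries respect a local relation on the first component. -/
theorem IsLocalOn.prod {K : Type*} {G : SimpleGraph V} {loc : B → V} (P : Setoid B)
    (hP : ∀ b : B, ∃ u v : V, (u = v ∨ G.Adj u v) ∧ ∀ b', P b b' → loc b' = u ∨ loc b' = v)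
    (M : Matrix (B × K) (B × K) ℂ) (hM : ∀ b b', ¬ P b.1 b'.1 → M b' b = 0) :
    IsLocalOn G (fun b : B × K => loc b.1) M := by
  refine ⟨P.comap Prod.fst, fun b b' h => hM b b' h, fun b => ?_⟩
  obtain ⟨u, v, huv, h⟩ := hP b.1
  exact ⟨u, v, huv, fun b' hb' => h b'.1 hb'⟩

theorem IsLocalOn.one_kronecker [DecidableEq B] {K : Type*} (G : SimpleGraph V) (loc : B → V)
    (M : Matrix K K ℂ) :
    IsLocalOn G (fun b : B × K => loc b.1) ((1 : Matrix B B ℂ).kronecker M) := by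
  refine IsLocalOn.prod ⊥ (fun b => ⟨loc b, loc b, Or.inl rfl, fun b' h => ?_⟩) _ fun b b' h => ?_
  · have h' : b = b' := h
    simp [h']
  · have h' : b'.1 ≠ b.1 := fun h' => h h'.symm
    simp [Matrix.kronecker, Matrix.kroneckerMap_apply, Matrix.one_apply_ne h']

theorem IsLocalOn.kronecker_one {K : Type*} [DecidableEq K] {G : SimpleGraph V} {loc : B → V}
    {M : Matrix B B ℂ} (hM : IsLocalOn G loc M) :
    IsLocalOn G (fun b : B × K => loc b.1) (M.kronecker (1 : Matrix K K ℂ)) := by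
  obtain ⟨P, h0, hP⟩ := hM
  refine IsLocalOn.prod P hP _ fun b b' h => ?_
  simp [Matrix.kronecker, Matrix.kroneckerMap_apply, h0 _ _ h]

theorem IsLocalOn.blockDiagonal [DecidableEq B] {K : Type*} [DecidableEq K] {G : SimpleGraph V}
    {loc : B → V} {M : Matrix B B ℂ} (hM : IsLocalOn G loc M) (p : K → Prop) [DecidablePred p] :
    IsLocalOn G (fun b : B × K => loc b.1)
      (Matrix.blockDiagonal fun i => if p i then M else 1) := by
  obtain ⟨P, h0, hP⟩ := hM
  refine IsLocalOn.prod P hP _ fun b b' h => ?_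
  rw [Matrix.blockDiagonal_apply]
  split_ifs with h1 h2
  · exact h0 _ _ h
  · exact Matrix.one_apply_ne fun h' => h (h' ▸ P.refl _)
  · rfl

/-! ### Extension of matrices and states along an injection of basis states -/

section Extension

variable {C S : Type*} [Fintype C] [DecidableEq C] [Fintype S] [DecidableEq S]
  (f : C → S) (hf : Function.Injective f)

/-- The identification of a set with the disjoint union of an embedded set and the rest. -/
noncomputable def splitRange : S ≃ C ⊕ ((Set.range f)ᶜ : Set S) := by
  classical
  exact (Equiv.Set.sumCompl (Set.range f)).symm.trans
    ((Equiv.ofInjective f hf).symm.sumCongr (Equiv.refl _))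

theorem splitRange_apply (c : C) : splitRange f hf (f c) = Sum.inl c := by
  have h : Equiv.ofInjective f hf c = ⟨f c, c, rfl⟩ := rfl
  rw [splitRange, Equiv.trans_apply, Equiv.Set.sumCompl_symm_apply_of_mem (Set.mem_range_self c), ← h]
  simp

theorem splitRange_eq_inl {s : S} {c : C} : splitRange f hf s = Sum.inl c ↔ s = f c := by
  rw [← splitRange_apply f hf, EmbeddingLike.apply_eq_iff_eq]

/-- The matrix acting as `M` on the embedded basis states and trivially on the others. -/
noncomputable def extendMatrix (M : Matrix C C ℂ) : Matrix S S ℂ := by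
  classical exact (Matrix.fromBlocks M 0 0 1).submatrix (splitRange f hf) (splitRange f hf)

/-- The state supported on the embedded basis states. -/
noncomputable def extendState (ψ : C → ℂ) : S → ℂ := Sum.elim ψ 0 ∘ splitRange f hf

theorem extendMatrix_mulVec (M : Matrix C C ℂ) (ψ : C → ℂ) :
    extendMatrix f hf M *ᵥ extendState f hf ψ = extendState f hf (M *ᵥ ψ) := by
  classical
  rw [extendMatrix, extendState, Matrix.submatrix_mulVec_equiv, Function.comp_assoc,
    Equiv.self_comp_symm, Function.comp_id, Matrix.fromBlocks_mulVec]
  simp only [Function.comp_def, Sum.elim_inl, Sum.elim_inr, Pi.zero_apply, Matrix.zero_mulVec,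
    Matrix.one_mulVec, add_zero, zero_add]
  congr! 2 with s

theorem extendMatrix_unitary {M : Matrix C C ℂ} (hM : M ∈ Matrix.unitaryGroup C ℂ) :
    extendMatrix f hf M ∈ Matrix.unitaryGroup S ℂ := by
  classical
  rw [Matrix.mem_unitaryGroup_iff] at hM ⊢
  rw [Matrix.star_eq_conjTranspose] at hM ⊢
  rw [extendMatrix, Matrix.conjTranspose_submatrix, Matrix.submatrix_mul_equiv,
    Matrix.fromBlocks_conjTranspose, Matrix.fromBlocks_multiply]
  simp [hM]

theorem extendState_apply (ψ : C → ℂ) (c : C) : extendState f hf ψ (f c) = ψ c := by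
  simp [extendState, splitRange_apply]

theorem extendState_apply_of_notMem (ψ : C → ℂ) {s : S} (hs : s ∉ Set.range f) :
    extendState f hf ψ s = 0 := by
  rcases h : splitRange f hf s with c | r
  · exact absurd ⟨c, ((splitRange_eq_inl f hf).1 h).symm⟩ hs
  · simp [extendState, h]

theorem extendState_single (c : C) :
    extendState f hf (Pi.single c 1) = Pi.single (f c) 1 := by
  funext s
  by_cases hs : s ∈ Set.range f
  · obtain ⟨c', rfl⟩ := hs
    rw [extendState_apply]
    simp [Pi.single_apply, hf.eq_iff]
  · rw [extendState_apply_of_notMem f hf _ hs, Pi.single_eq_of_ne]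
    rintro rfl
    exact hs ⟨c, rfl⟩

theorem sum_extendState (ψ : C → ℂ) (p : S → Prop) [DecidablePred p] :
    ∑ s with p s, ‖extendState f hf ψ s‖ ^ 2 = ∑ c with p (f c), ‖ψ c‖ ^ 2 := by
  rw [Finset.sum_filter, Finset.sum_filter]
  symm
  apply Finset.sum_of_injOn f hf.injOn (by simp)
  · intro s _ hs
    rw [extendState_apply_of_notMem f hf _ (by simpa using hs)]
    simp
  · intro c _
    rw [extendState_apply]

/-- Basis states outside the range are untouched and may be singleton classes; the map `g` labels
the resulting partition. -/
theorem extendMatrix_local {w : ℕ} {V : Type*} [Fintype V] [DecidableEq V] {G : SimpleGraph V}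
    (f : C → BasisState V w) (hf : Function.Injective f) {M : Matrix C C ℂ}
    (hM : IsLocalOn G (fun c => (f c).1) M) : IsCLocal G (extendMatrix f hf M) := by
  classical
  obtain ⟨P, h0, hP⟩ := hM
  let g : BasisState V w → Quotient P ⊕ ((Set.range f)ᶜ : Set (BasisState V w)) :=
    fun b => Sum.map (Quotient.mk P) id (splitRange f hf b)
  refine ⟨Setoid.ker g, fun b b' h => ?_, fun S hS => ?_⟩
  · have h' : g b ≠ g b' := h
    simp only [extendMatrix, Matrix.submatrix_apply]
    simp only [g] at h'
    rcases hb : splitRange f hf b with c | r <;> rcases hb' : splitRange f hf b' with c' | r' <;>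
      simp only [hb, hb', Sum.map_inl, Sum.map_inr, ne_eq, Sum.inl.injEq, Sum.inr.injEq, id,
        reduceCtorEq, not_false_eq_true] at h' <;>
      simp only [Matrix.fromBlocks_apply₁₁, Matrix.fromBlocks_apply₁₂,
        Matrix.fromBlocks_apply₂₁, Matrix.fromBlocks_apply₂₂, Matrix.zero_apply]
    · exact h0 _ _ fun h => h' (Quotient.sound h)
    · exact Matrix.one_apply_ne fun h => h' h.symm
  · obtain ⟨b, rfl⟩ := hS
    rcases hb : splitRange f hf b with c | r
    · obtain ⟨u, v, huv, h⟩ := hP c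
      refine ⟨u, v, huv, fun b' hb' => ?_⟩
      have hg : g b' = g b := hb'
      rcases hb2 : splitRange f hf b' with c' | r'
      · simp only [g, hb, hb2, Sum.map_inl, Sum.inl.injEq] at hg
        rw [(splitRange_eq_inl f hf).1 hb2]
        exact h c' (Quotient.exact hg.symm)
      · simp [g, hb, hb2] at hg
    · refine ⟨b.1, b.1, Or.inl rfl, fun b' hb' => ?_⟩
      have hg : g b' = g b := hb'
      rcases hb2 : splitRange f hf b' with c' | r'
      · simp [g, hb, hb2] at hg
      · simp only [g, hb, hb2, Sum.map_inr, Sum.inr.injEq, id] at hg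
        rw [hg, ← hb] at hb2
        simp [(splitRange f hf).injective hb2]

end Extension

/-! ### Circuits with sign queries, and the robots that run them -/

section Circuit

variable [Fintype V] [DecidableEq V] [Fintype B] [DecidableEq B]

/-- A circuit whose rounds are a local unitary, a sign depending on whether the current vertex is
marked, and another local unitary. -/
structure Circuit (G : SimpleGraph V) (loc : B → V) where
  pre : ℕ → Matrix B B ℂ
  sgn : ℕ → B → Bool → ℂ
  post : ℕ → Matrix B B ℂ
  pre_unitary : ∀ t, pre t ∈ Matrix.unitaryGroup B ℂ
  post_unitary : ∀ t, post t ∈ Matrix.unitaryGroup B ℂ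
  sgn_sign : ∀ t b q, sgn t b q = 1 ∨ sgn t b q = -1
  pre_local : ∀ t, IsLocalOn G loc (pre t)
  post_local : ∀ t, IsLocalOn G loc (post t)

variable {G : SimpleGraph V} {loc : B → V}

/-- The state of the circuit after `t` rounds. -/
noncomputable def Circuit.state (c : Circuit G loc) (b₀ : B) (X : V → Bool) : ℕ → B → ℂ
  | 0 => Pi.single b₀ 1
  | t + 1 => c.post t *ᵥ fun b => c.sgn t b (X (loc b)) * (c.pre t *ᵥ c.state b₀ X t) b

/-- The basis state of a robot that encodes a basis state of a circuit and a query bit. -/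
noncomputable def encode (loc : B → V) (b₀ : B) (out : B → Bool) (c : B × Bool) :
    BasisState V (Fintype.card B + 1) :=
  (loc c.1, Fin.cons c.2 (Fin.cons (out c.1)
    -- A one-hot code, except that `b₀` is coded by zeros: the robot has to start in the all-zero
    -- bit string.
    fun i => decide (c.1 ≠ b₀ ∧ (Fintype.equivFin B).symm i = c.1)))

theorem encode_injective (loc : B → V) (b₀ : B) (out : B → Bool) :
    Function.Injective (encode loc b₀ out) := by
  rintro ⟨b, q⟩ ⟨b', q'⟩ h
  simp only [encode, Prod.mk.injEq, Fin.cons_inj] at h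
  obtain ⟨-, rfl, -, h⟩ := h
  have h1 := congrFun h (Fintype.equivFin B b)
  have h2 := congrFun h (Fintype.equivFin B b')
  simp only [Equiv.symm_apply_apply, decide_eq_decide] at h1 h2
  have : b = b' := by
    by_cases hb : b = b₀ <;> by_cases hb' : b' = b₀ <;> grind
  rw [this]

theorem query_encode (loc : B → V) (b₀ : B) (out : B → Bool) (X : V → Bool) (c : B × Bool) :
    query X (encode loc b₀ out c) = encode loc b₀ out (c.1, xor c.2 (X (loc c.1))) := by
  simp [query, encode, Fin.update_cons_zero]

theorem oracle_extendState (loc : B → V) (b₀ : B) (out : B → Bool) (X : V → Bool)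
    (ψ : B × Bool → ℂ) :
    oracle X (extendState (encode loc b₀ out) (encode_injective loc b₀ out) ψ) =
      extendState (encode loc b₀ out) (encode_injective loc b₀ out)
        fun c => ψ (c.1, xor c.2 (X (loc c.1))) := by
  funext s
  simp only [oracle]
  by_cases hs : s ∈ Set.range (encode loc b₀ out)
  · obtain ⟨c, rfl⟩ := hs
    rw [query_encode, extendState_apply, extendState_apply]
  · rw [extendState_apply_of_notMem _ _ _ hs, extendState_apply_of_notMem]
    rintro ⟨c, hc⟩
    exact hs ⟨_, by rw [← query_encode, hc, query_query]⟩

theorem kronecker_one_mulVec (M : Matrix B B ℂ) {K : Type*} [Fintype K] [DecidableEq K]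
    (ψ : B × K → ℂ) (c : B × K) :
    (M.kronecker (1 : Matrix K K ℂ) *ᵥ ψ) c = (M *ᵥ fun b => ψ (b, c.2)) c.1 := by
  simp [Matrix.mulVec, dotProduct, Fintype.sum_prod_type, Matrix.kronecker,
    Matrix.kroneckerMap_apply, Matrix.one_apply]

/-- The robot that runs a circuit, spending four steps on each round. -/
noncomputable def Circuit.robot (c : Circuit G loc) (b₀ : B) (out : B → Bool) : Robot G where
  w := Fintype.card B + 1
  out := 1
  -- An oracle call follows every step. The call after `pre` writes the mark into the query bit, and
  -- the one after the sign erases it. The call after `post` writes it again, which is why an idle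
  -- fourth step is needed to erase it.
  step m :=
    if m % 4 = 0 then extendMatrix (encode loc b₀ out) (encode_injective loc b₀ out)
      ((c.pre (m / 4)).kronecker (1 : Matrix Bool Bool ℂ))
    else if m % 4 = 1 then extendMatrix (encode loc b₀ out) (encode_injective loc b₀ out)
      (Matrix.diagonal fun b : B × Bool => c.sgn (m / 4) b.1 b.2)
    else if m % 4 = 2 then extendMatrix (encode loc b₀ out) (encode_injective loc b₀ out)
      ((c.post (m / 4)).kronecker (1 : Matrix Bool Bool ℂ))
    else 1
  step_unitary m := by
    split_ifs
    · exact extendMatrix_unitary _ _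
        (Matrix.kronecker_mem_unitary (c.pre_unitary _) (one_mem _))
    · refine extendMatrix_unitary _ _ ?_
      rw [Matrix.mem_unitaryGroup_iff, Matrix.star_eq_conjTranspose,
        Matrix.diagonal_conjTranspose, Matrix.diagonal_mul_diagonal, ← Matrix.diagonal_one]
      congr 1
      funext b
      rcases c.sgn_sign (m / 4) b.1 b.2 with h | h <;> simp [h]
    · exact extendMatrix_unitary _ _
        (Matrix.kronecker_mem_unitary (c.post_unitary _) (one_mem _))
    · exact one_mem _
  step_cLocal m := by
    split_ifs
    · exact extendMatrix_local _ _ (c.pre_local _).kronecker_one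
    · exact extendMatrix_local _ _ (IsLocalOn.diagonal _ _ _)
    · exact extendMatrix_local _ _ (c.post_local _).kronecker_one
    · refine ⟨⊥, fun b b' h => Matrix.one_apply_ne fun h' => h h'.symm, ?_⟩
      rintro S ⟨b, rfl⟩
      refine ⟨b.1, b.1, Or.inl rfl, fun b' h => ?_⟩
      have h' : b' = b := h
      simp [h']

theorem Circuit.robot_state (c : Circuit G loc) {b₀ : B} {out : B → Bool} (h0 : out b₀ = false)
    (X : V → Bool) (t : ℕ) :
    (c.robot b₀ out).state (loc b₀) X (4 * t) =
      extendState (encode loc b₀ out) (encode_injective loc b₀ out)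
        fun b => if b.2 then 0 else c.state b₀ X t b.1 := by
  induction t with
  | zero =>
    have h1 : (fun b : B × Bool => if b.2 then (0 : ℂ) else c.state b₀ X 0 b.1) =
        Pi.single (b₀, false) 1 := by
      funext ⟨b, q⟩
      cases q <;> simp [Circuit.state, Pi.single_apply]
    rw [h1, extendState_single]
    have h2 : encode loc b₀ out (b₀, false) = (loc b₀, fun _ => false) := by
      simp only [encode, h0, ne_eq, not_true_eq_false, false_and, decide_false, Prod.mk.injEq,
        true_and]
      funext i
      refine Fin.cases rfl (fun i => ?_) i
      refine Fin.cases rfl (fun i => ?_) i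
      simp
    rw [h2]
    rfl
  | succ t ih =>
    have e0 : 4 * t % 4 = 0 := by omega
    have e1 : (4 * t + 1) % 4 = 1 := by omega
    have e2 : (4 * t + 2) % 4 = 2 := by omega
    have e3 : (4 * t + 3) % 4 = 3 := by omega
    have d0 : 4 * t / 4 = t := by omega
    have d1 : (4 * t + 1) / 4 = t := by omega
    have d2 : (4 * t + 2) / 4 = t := by omega
    have s0 : (c.robot b₀ out).step (4 * t) = _ := if_pos e0
    have s1 : (c.robot b₀ out).step (4 * t + 1) = _ :=
      (if_neg (by omega)).trans (if_pos e1)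
    have s2 : (c.robot b₀ out).step (4 * t + 2) = _ :=
      (if_neg (by omega)).trans ((if_neg (by omega)).trans (if_pos e2))
    have s3 : (c.robot b₀ out).step (4 * t + 3) = _ :=
      (if_neg (by omega)).trans ((if_neg (by omega)).trans (if_neg (by omega)))
    rw [d0] at s0
    rw [d1] at s1
    rw [d2] at s2
    have run : ∀ (m : ℕ) (M : Matrix (B × Bool) (B × Bool) ℂ) (ψ : B × Bool → ℂ),
        (c.robot b₀ out).step m = extendMatrix (encode loc b₀ out) (encode_injective loc b₀ out) M →
        (c.robot b₀ out).state (loc b₀) X m =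
          extendState (encode loc b₀ out) (encode_injective loc b₀ out) ψ →
        (c.robot b₀ out).state (loc b₀) X (m + 1) =
          extendState (encode loc b₀ out) (encode_injective loc b₀ out)
            fun b => (M *ᵥ ψ) (b.1, xor b.2 (X (loc b.1))) := by
      intro m M ψ h1 h2
      rw [Robot.state, h1, h2]
      exact (congrArg (oracle X) (extendMatrix_mulVec _ _ M ψ)).trans
        (oracle_extendState loc b₀ out X _)
    have r2 := run _ _ _ s2 (run _ _ _ s1 (run _ _ _ s0 ih))
    have r3 : (c.robot b₀ out).state (loc b₀) X (4 * (t + 1)) =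
        oracle X ((c.robot b₀ out).state (loc b₀) X (4 * t + 3)) := by
      rw [show 4 * (t + 1) = 4 * t + 3 + 1 by ring, Robot.state, s3]
      exact congrArg (oracle X) (Matrix.one_mulVec _)
    rw [r3, r2]
    refine (oracle_extendState loc b₀ out X _).trans ?_
    congr 1
    funext ⟨b, q⟩
    simp only [kronecker_one_mulVec, Matrix.mulVec_diagonal]
    have hz : (fun _ : B => (0 : ℂ)) = 0 := rfl
    have key : ∀ (b : B) (q : Bool),
        (c.pre t *ᵥ fun b => if q then (0 : ℂ) else c.state b₀ X t b) b =
          if q then 0 else (c.pre t *ᵥ c.state b₀ X t) b := by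
      intro b q
      cases q <;> simp [hz]
    simp only [key]
    cases q <;> simp [Circuit.state, hz]

theorem Circuit.robot_outputProb (c : Circuit G loc) {b₀ : B} {out : B → Bool}
    (h0 : out b₀ = false) (X : V → Bool) (t : ℕ) (y : Bool) :
    (c.robot b₀ out).outputProb (loc b₀) X (4 * t) y =
      ∑ b with out b = y, ‖c.state b₀ X t b‖ ^ 2 := by
  have h1 : ∀ b q, (encode loc b₀ out (b, q)).2 1 = out b := fun b q => rfl
  unfold Robot.outputProb
  rw [c.robot_state h0]
  refine (sum_extendState _ _ _ (fun b : BasisState V (Fintype.card B + 1) => b.2 1 = y)).trans ?_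
  rw [Finset.sum_filter, Fintype.sum_prod_type, Finset.sum_filter]
  refine Finset.sum_congr rfl fun b _ => ?_
  simp [h1]

theorem sum_norm_sq_unitary_mulVec {U : Matrix B B ℂ} (hU : U ∈ Matrix.unitaryGroup B ℂ)
    (ψ : B → ℂ) : ∑ b, ‖(U *ᵥ ψ) b‖ ^ 2 = ∑ b, ‖ψ b‖ ^ 2 := by
  have key : ∀ φ : B → ℂ, ((∑ b, ‖φ b‖ ^ 2 : ℝ) : ℂ) = star φ ⬝ᵥ φ := by
    intro φ
    simp [dotProduct, ← Complex.conj_mul']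
  have h : ((∑ b, ‖(U *ᵥ ψ) b‖ ^ 2 : ℝ) : ℂ) = ((∑ b, ‖ψ b‖ ^ 2 : ℝ) : ℂ) := by
    rw [key, key, Matrix.star_mulVec, ← Matrix.dotProduct_mulVec, Matrix.mulVec_mulVec,
      ← Matrix.star_eq_conjTranspose, Matrix.mem_unitaryGroup_iff'.1 hU, Matrix.one_mulVec]
  exact_mod_cast h

theorem Circuit.sum_state (c : Circuit G loc) (b₀ : B) (X : V → Bool) (t : ℕ) :
    ∑ b, ‖c.state b₀ X t b‖ ^ 2 = 1 := by
  induction t with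
  | zero =>
    rw [Finset.sum_eq_single b₀] <;> simp +contextual [Circuit.state]
  | succ t ih =>
    rw [Circuit.state, sum_norm_sq_unitary_mulVec (c.post_unitary t), ← ih,
      ← sum_norm_sq_unitary_mulVec (c.pre_unitary t) (c.state b₀ X t)]
    refine Finset.sum_congr rfl fun b _ => ?_
    rcases c.sgn_sign t b (X (loc b)) with h | h <;> simp [h]

end Circuit

end Simulation

end SpatialSearch

namespace SpatialSearch

/-! ### Reflections about the fibres of a map -/

section Reflection

variable {E K : Type*} [Fintype E] [DecidableEq E] [DecidableEq K]

/-- The product of the reflections about the orthogonal complements of the restrictions of the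
vector `φ` to the fibres of `a`. -/
noncomputable def fibreReflection (a : E → K) (φ : E → ℝ) : Matrix E E ℂ :=
  1 - Matrix.of fun e e' =>
    if a e = a e' then ((2 * φ e * φ e' / ∑ f with a f = a e, φ f ^ 2 : ℝ) : ℂ) else 0

theorem fibreReflection_mulVec (a : E → K) (φ : E → ℝ) (f : E → ℂ) (e : E) :
    (fibreReflection a φ *ᵥ f) e =
      f e - 2 * φ e / (∑ e' with a e' = a e, (φ e' : ℂ) ^ 2) *
        ∑ e' with a e' = a e, φ e' * f e' := by
  rw [fibreReflection, Matrix.sub_mulVec, Matrix.one_mulVec, Pi.sub_apply]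
  congr 1
  simp only [Matrix.mulVec, dotProduct, Matrix.of_apply, Finset.mul_sum, Finset.sum_filter]
  refine Finset.sum_congr rfl fun e' _ => ?_
  by_cases h : a e = a e'
  · simp only [h, if_true]
    push_cast
    simp only [apply_ite Complex.ofReal, Complex.ofReal_pow, Complex.ofReal_zero]
    ring
  · rw [if_neg h, if_neg (fun h' => h h'.symm)]
    simp

theorem fibreReflection_mulVec_of_orthogonal {a : E → K} {φ : E → ℝ} {f : E → ℂ} {e : E}
    (h : φ e = 0 ∨ ∑ e' with a e' = a e, φ e' * f e' = 0) :
    (fibreReflection a φ *ᵥ f) e = f e := by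
  rw [fibreReflection_mulVec]
  rcases h with h | h <;> simp [h]

/-- Handles the fibres where `fibreReflection` divides by zero: `φ` vanishes there, so the
reflection acts as the identity. Such fibres do occur, since unused names of nodes get weight zero.
-/
theorem fibreSum_sq_eq_zero {a : E → K} {φ : E → ℝ} {e : E}
    (h : ∑ e' with a e' = a e, (φ e' : ℂ) ^ 2 = 0) : ∀ e', a e' = a e → φ e' = 0 := by
  intro e' he'
  have h' : ∑ e' with a e' = a e, φ e' ^ 2 = 0 := by exact_mod_cast h
  have := (Finset.sum_eq_zero_iff_of_nonneg fun i _ => sq_nonneg (φ i)).1 h' e' (by simp [he'])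
  simpa using this

theorem fibreReflection_mulVec_self (a : E → K) (φ : E → ℝ) :
    (fibreReflection a φ *ᵥ fun e => (φ e : ℂ)) = fun e => -(φ e : ℂ) := by
  funext e
  rw [fibreReflection_mulVec]
  simp only [← pow_two]
  by_cases h : ∑ e' with a e' = a e, (φ e' : ℂ) ^ 2 = 0
  · simp [fibreSum_sq_eq_zero h e rfl]
  · field_simp
    ring

/-- A reflection flips the component along `φ` in each fibre, so applying it twice cancels both
corrections. -/
theorem fibreSum_fibreReflection (a : E → K) (φ : E → ℝ) (f : E → ℂ) (e : E) :
    ∑ e' with a e' = a e, φ e' * (fibreReflection a φ *ᵥ f) e' =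
      -∑ e' with a e' = a e, φ e' * f e' := by
  have h1 : ∑ e' with a e' = a e, φ e' * (fibreReflection a φ *ᵥ f) e' =
      ∑ e' with a e' = a e, (φ e' * f e' - (φ e' : ℂ) ^ 2 *
        (2 / (∑ e' with a e' = a e, (φ e' : ℂ) ^ 2) * ∑ e' with a e' = a e, φ e' * f e')) := by
    refine Finset.sum_congr rfl fun e' he' => ?_
    rw [fibreReflection_mulVec, (Finset.mem_filter.1 he').2]
    ring
  rw [h1, Finset.sum_sub_distrib, ← Finset.sum_mul]
  by_cases h : ∑ e' with a e' = a e, (φ e' : ℂ) ^ 2 = 0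
  · have : ∑ e' with a e' = a e, φ e' * f e' = 0 :=
      Finset.sum_eq_zero fun e' he' => by
        simp [fibreSum_sq_eq_zero h e' (Finset.mem_filter.1 he').2]
    simp [this]
  · field_simp
    ring

theorem fibreReflection_mul_self (a : E → K) (φ : E → ℝ) :
    fibreReflection a φ * fibreReflection a φ = 1 := by
  refine Matrix.ext_of_mulVec_single fun i => ?_
  funext e
  rw [← Matrix.mulVec_mulVec, fibreReflection_mulVec, fibreSum_fibreReflection,
    fibreReflection_mulVec, Matrix.one_mulVec]
  ring

theorem fibreReflection_conjTranspose (a : E → K) (φ : E → ℝ) :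
    (fibreReflection a φ)ᴴ = fibreReflection a φ := by
  ext e e'
  simp only [fibreReflection, Matrix.conjTranspose_apply, Matrix.sub_apply, star_sub,
    Matrix.of_apply]
  congr 1
  · simp [Matrix.one_apply, eq_comm]
  · by_cases h : a e = a e'
    · simp only [h, if_true]
      rw [mul_right_comm]
      exact Complex.conj_ofReal _
    · rw [if_neg h, if_neg (fun h' => h h'.symm), star_zero]

theorem fibreReflection_unitary (a : E → K) (φ : E → ℝ) :
    fibreReflection a φ ∈ Matrix.unitaryGroup E ℂ := by
  rw [Matrix.mem_unitaryGroup_iff, Matrix.star_eq_conjTranspose, fibreReflection_conjTranspose,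
    fibreReflection_mul_self]

theorem fibreReflection_local {V : Type*} {G : SimpleGraph V} {loc : E → V} (a : E → K)
    (φ : E → ℝ)
    (h : ∀ e : E, ∃ u v : V, (u = v ∨ G.Adj u v) ∧ ∀ e', a e' = a e → loc e' = u ∨ loc e' = v) :
    IsLocalOn G loc (fibreReflection a φ) := by
  refine ⟨Setoid.ker a, fun e e' he => ?_, fun e => ?_⟩
  · have he' : ¬ a e' = a e := fun h => he h.symm
    have : e' ≠ e := fun h => he' (h ▸ rfl)
    simp [fibreReflection, he', Matrix.one_apply_ne this]
  · obtain ⟨u, v, huv, h'⟩ := h e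
    exact ⟨u, v, huv, fun e' he' => h' e' (Eq.symm he')⟩

/-- The reflection that exchanges two real unit vectors. -/
theorem fibreReflection_mulVec_exchange (x y : E → ℝ) (hx : ∑ e, x e ^ 2 = 1)
    (hy : ∑ e, y e ^ 2 = 1) :
    (fibreReflection (fun _ => ()) (x - y) *ᵥ fun e => (x e : ℂ)) = fun e => (y e : ℂ) := by
  funext e
  have h1 : ∑ e', (x e' - y e') * x e' = 1 - ∑ e', x e' * y e' := by
    rw [← hx, ← Finset.sum_sub_distrib]
    exact Finset.sum_congr rfl fun _ _ => by ring
  have h2 : ∑ e', (x e' - y e') ^ 2 = 2 * (1 - ∑ e', x e' * y e') := by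
    have : ∑ e', (x e' - y e') ^ 2 = ∑ e', (x e' ^ 2 + y e' ^ 2 - 2 * (x e' * y e')) :=
      Finset.sum_congr rfl fun _ _ => by ring
    rw [this, Finset.sum_sub_distrib, Finset.sum_add_distrib, hx, hy, ← Finset.mul_sum]
    ring
  rw [fibreReflection_mulVec]
  simp only [Finset.filter_true, Pi.sub_apply]
  have key : x e - 2 * (x e - y e) / (∑ e', (x e' - y e') ^ 2) *
      (∑ e', (x e' - y e') * x e') = y e := by
    -- Unit vectors with inner product 1 coincide, and the matrix is then the identity.
    by_cases h : 1 - ∑ e', x e' * y e' = 0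
    · rw [h, mul_zero] at h2
      have := (Finset.sum_eq_zero_iff_of_nonneg fun i _ => sq_nonneg (x i - y i)).1 h2 e
        (Finset.mem_univ e)
      have h3 : x e - y e = 0 := by simpa using this
      rw [h3, mul_zero, zero_div, zero_mul]
      linarith
    · rw [h1, h2]
      field_simp
      ring
  exact_mod_cast congrArg Complex.ofReal key

end Reflection

/-! ### Detecting an approximately invariant component of the starting state -/

section PhaseTest

variable {V E : Type*} [Fintype V] [DecidableEq V] [Fintype E] [DecidableEq E]
  {G : SimpleGraph V} {loc : E → V}

/-- The unit vector that is uniform on the counter values `some i`. -/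
noncomputable def uniformCounter (N : ℕ) (r : Option (Fin (N + 1))) : ℝ :=
  r.elim 0 fun _ => 1 / Real.sqrt (N + 1)

theorem sum_uniformCounter_sq (N : ℕ) : ∑ r, uniformCounter N r ^ 2 = 1 := by
  have h : (0 : ℝ) ≤ N + 1 := by positivity
  simp only [uniformCounter, Fintype.sum_option, Option.elim]
  simp only [div_pow, one_pow, Real.sq_sqrt h, Finset.sum_const, Finset.card_univ,
    Fintype.card_fin, nsmul_eq_mul]
  push_cast
  field_simp
  ring

/-- The reflection exchanging a basis state of the counter with the uniform superposition. -/
noncomputable def counterReflection (N : ℕ) (r : Option (Fin (N + 1))) :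
    Matrix (Option (Fin (N + 1))) (Option (Fin (N + 1))) ℂ :=
  fibreReflection (fun _ => ()) (Pi.single r 1 - uniformCounter N)

theorem counterReflection_apply (N : ℕ) (r r' : Option (Fin (N + 1))) :
    counterReflection N r r' r = uniformCounter N r' := by
  have h := fibreReflection_mulVec_exchange (Pi.single r 1) (uniformCounter N)
    (by simp [Pi.single_apply]) (sum_uniformCounter_sq N)
  have h1 : (fun e => ((Pi.single r 1 : Option (Fin (N + 1)) → ℝ) e : ℂ)) = Pi.single r 1 := by
    funext e
    by_cases he : e = r
    · subst he; simp
    · simp [he]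
  rw [h1, Matrix.mulVec_single_one] at h
  exact congrFun h r'

theorem counterReflection_apply' (N : ℕ) (r r' : Option (Fin (N + 1))) :
    counterReflection N r r r' = uniformCounter N r' := by
  have h : (counterReflection N r)ᴴ = counterReflection N r := fibreReflection_conjTranspose _ _
  rw [← h, Matrix.conjTranspose_apply, counterReflection_apply]
  exact Complex.conj_ofReal _

/-- The matrix of one step of a walk with a sign query between two unitaries. -/
def walkMatrix (loc : E → V) (A B : Matrix E E ℂ) (leaf : E → Bool) (X : V → Bool) :
    Matrix E E ℂ :=
  B * Matrix.diagonal (fun e => if leaf e && X (loc e) then -1 else 1) * A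

/-- Whether the walk is still to be moved in the `t`-th round. -/
def isActive {N : ℕ} (t : ℕ) (r : Option (Fin (N + 1))) : Bool :=
  r.elim false fun i => decide (t < i)

theorem blockDiagonal_unitary {K : Type*} [Fintype K] [DecidableEq K] {A : Matrix E E ℂ}
    (hA : A ∈ Matrix.unitaryGroup E ℂ) (p : K → Bool) :
    (Matrix.blockDiagonal fun r => if p r then A else 1) ∈ Matrix.unitaryGroup (E × K) ℂ := by
  rw [Matrix.mem_unitaryGroup_iff, Matrix.star_eq_conjTranspose] at *
  rw [Matrix.blockDiagonal_conjTranspose, ← Matrix.blockDiagonal_mul, ← Matrix.blockDiagonal_one]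
  congr 1
  funext r
  by_cases h : p r = true <;> simp [h, hA]

theorem blockDiagonal_mulVec {K : Type*} [Fintype K] [DecidableEq K] (M : K → Matrix E E ℂ)
    (ψ : E × K → ℂ) (b : E × K) :
    (Matrix.blockDiagonal M *ᵥ ψ) b = (M b.2 *ᵥ fun e => ψ (e, b.2)) b.1 := by
  simp [Matrix.mulVec, dotProduct, Fintype.sum_prod_type, Matrix.blockDiagonal_apply]

theorem one_kronecker_mulVec {K : Type*} [Fintype K] [DecidableEq K] (M : Matrix K K ℂ)
    (ψ : E × K → ℂ) (b : E × K) :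
    ((1 : Matrix E E ℂ).kronecker M *ᵥ ψ) b = ∑ r, M b.2 r * ψ (b.1, r) := by
  simp [Matrix.mulVec, dotProduct, Fintype.sum_prod_type, Matrix.kronecker,
    Matrix.kroneckerMap_apply, Matrix.one_apply]

/-- The circuit that runs the walk for a number of steps given by a counter in uniform
superposition, and then compares the counter with the uniform superposition. -/
noncomputable def phaseTest (N : ℕ) (A B : Matrix E E ℂ) (leaf : E → Bool)
    (hA : A ∈ Matrix.unitaryGroup E ℂ) (hB : B ∈ Matrix.unitaryGroup E ℂ)
    (lA : IsLocalOn G loc A) (lB : IsLocalOn G loc B) :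
    Circuit G fun b : E × Option (Fin (N + 1)) => loc b.1 where
  -- Round 0 prepares the counter, rounds 1 to N let the branch `some i` make i steps, and round N +
  -- 1 maps the uniform superposition to `some 0`. The initial value `none` differs from the
  -- accepting value `some 0` because the output bit must start at 0.
  pre t := if t = 0 then (1 : Matrix E E ℂ).kronecker (counterReflection N none)
    else if t ≤ N then Matrix.blockDiagonal fun r => if isActive (t - 1) r then A else 1
    else (1 : Matrix E E ℂ).kronecker (counterReflection N (some 0))
  sgn t b q := if t ≠ 0 ∧ t ≤ N ∧ isActive (t - 1) b.2 ∧ leaf b.1 ∧ q then -1 else 1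
  post t := if t ≠ 0 ∧ t ≤ N then Matrix.blockDiagonal fun r => if isActive (t - 1) r then B else 1
    else (1 : Matrix E E ℂ).kronecker 1
  pre_unitary t := by
    split_ifs
    · exact Matrix.kronecker_mem_unitary (one_mem _) (fibreReflection_unitary _ _)
    · exact blockDiagonal_unitary hA _
    · exact Matrix.kronecker_mem_unitary (one_mem _) (fibreReflection_unitary _ _)
  post_unitary t := by
    split_ifs
    · exact blockDiagonal_unitary hB _
    · exact Matrix.kronecker_mem_unitary (one_mem _) (one_mem _)
  sgn_sign t b q := by split_ifs <;> simp
  pre_local t := by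
    split_ifs
    · exact IsLocalOn.one_kronecker _ _ _
    · exact lA.blockDiagonal _
    · exact IsLocalOn.one_kronecker _ _ _
  post_local t := by
    split_ifs
    · exact lB.blockDiagonal _
    · exact IsLocalOn.one_kronecker _ _ _

section

variable (N : ℕ) (A B : Matrix E E ℂ) (leaf : E → Bool)
    (hA : A ∈ Matrix.unitaryGroup E ℂ) (hB : B ∈ Matrix.unitaryGroup E ℂ)
    (lA : IsLocalOn G loc A) (lB : IsLocalOn G loc B) (ρ : E) (X : V → Bool)

/-- The branch with counter i stops moving after i steps, whence the minimum. -/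
theorem phaseTest_state {t : ℕ} (ht : t ≤ N) :
    (phaseTest N A B leaf hA hB lA lB).state (ρ, none) X (t + 1) =
      fun b => b.2.elim 0 fun i => ((1 / Real.sqrt (N + 1) : ℝ) : ℂ) *
        ((walkMatrix loc A B leaf X ^ min (i : ℕ) t) *ᵥ Pi.single ρ 1) b.1 := by
  induction t with
  | zero =>
    funext b
    simp only [Circuit.state, phaseTest, if_true, ne_eq, not_true_eq_false, false_and, if_false,
      one_mul, one_kronecker_mulVec]
    obtain ⟨e, r⟩ := b
    simp only [Matrix.one_apply, ite_mul, one_mul, zero_mul, Finset.sum_ite_eq, Finset.mem_univ,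
      if_true]
    rw [Finset.sum_eq_single none]
    · rw [counterReflection_apply]
      cases r <;> simp [uniformCounter, Pi.single_apply, Matrix.one_apply]
    · intro r' _ hr'
      simp [hr']
    · simp
  | succ t ih =>
    rw [Circuit.state, ih (by omega)]
    funext ⟨e, r⟩
    have h0 : t + 1 ≠ 0 := by omega
    simp only [phaseTest, h0, if_false, ht, if_true, ne_eq, not_false_eq_true, true_and, and_self,
      Nat.add_sub_cancel, blockDiagonal_mulVec]
    cases r with
    | none =>
      have : (fun _ : E => (0 : ℂ)) = 0 := rfl
      simp [isActive, this]
    | some i =>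
      simp only [isActive, Option.elim, decide_eq_true_eq]
      by_cases hi : t < i
      · have h1 : min (i : ℕ) t = t := by omega
        have h2 : min (i : ℕ) (t + 1) = t + 1 := by omega
        simp only [hi, if_true, true_and, h1, h2]
        set c : ℂ := ((1 / Real.sqrt (N + 1) : ℝ) : ℂ)
        have h3 : (fun e => c * (walkMatrix loc A B leaf X ^ t *ᵥ Pi.single ρ 1) e) =
          c • (walkMatrix loc A B leaf X ^ t *ᵥ Pi.single ρ 1) := rfl
        rw [h3, pow_succ', ← Matrix.mulVec_mulVec]
        nth_rewrite 2 [walkMatrix]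
        rw [← Matrix.mulVec_mulVec, ← Matrix.mulVec_mulVec]
        change _ = (c • (_ : E → ℂ)) _
        rw [← Matrix.mulVec_smul, ← Matrix.mulVec_smul, ← Matrix.mulVec_smul]
        congr 1
        funext e
        rw [Matrix.mulVec_diagonal, Matrix.mulVec_smul]
        congr 1
        · simp
        · rw [Matrix.mulVec_smul]
      · have h1 : min (i : ℕ) t = i := by omega
        have h2 : min (i : ℕ) (t + 1) = i := by omega
        simp [hi, h1, h2]

/-- The probability that the counter ends in the distinguished state is the squared norm of the
average of the first iterates of the walk. -/
theorem phaseTest_prob :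
    ∑ b with decide (b.2 = some 0) = true,
      ‖(phaseTest N A B leaf hA hB lA lB).state (ρ, none) X (N + 2) b‖ ^ 2 =
    ∑ e, ‖(1 / (N + 1) : ℂ) * ∑ i ∈ Finset.range (N + 1),
      ((walkMatrix loc A B leaf X ^ i) *ᵥ Pi.single ρ 1) e‖ ^ 2 := by
  rw [Finset.sum_filter, Fintype.sum_prod_type]
  refine Finset.sum_congr rfl fun e _ => ?_
  rw [Finset.sum_eq_single (some 0) (by simp +contextual) (by simp)]
  simp only [decide_true, if_true]
  rw [Circuit.state, phaseTest_state _ _ _ _ _ _ _ _ _ _ le_rfl]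
  have h0 : ¬ N + 1 = 0 := by omega
  have h1 : ¬ N + 1 ≤ N := by omega
  simp only [phaseTest, h0, h1, if_false, and_false, false_and, one_mul, one_kronecker_mulVec]
  simp only [Matrix.one_apply, ite_mul, one_mul, zero_mul, Finset.sum_ite_eq, Finset.mem_univ,
    if_true, Fintype.sum_option, Option.elim, mul_zero,
    zero_add]
  congr 2
  rw [Finset.mul_sum, Finset.sum_range]
  refine Finset.sum_congr rfl fun i _ => ?_
  have h2 : min (i : ℕ) N = i := by omega
  have h3 : ((1 / Real.sqrt (N + 1) : ℝ) : ℂ) * ((1 / Real.sqrt (N + 1) : ℝ) : ℂ) =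
      1 / (N + 1) := by
    rw [← Complex.ofReal_mul, div_mul_div_comm, Real.mul_self_sqrt (by positivity)]
    push_cast
    ring
  have h4 : counterReflection N (some 0) (some 0) (some i) = ((1 / Real.sqrt (N + 1) : ℝ) : ℂ) :=
    counterReflection_apply' N (some 0) (some i)
  rw [h2, ← mul_assoc, ← h3]
  exact congrArg (fun z : ℂ => z * _ * _) h4

end

/-- If the average of the first iterates of the walk has a large norm exactly on the inputs with
value `true`, there is a robot that evaluates the function. -/
theorem exists_robot_of_walk (N : ℕ) (A B : Matrix E E ℂ) (leaf : E → Bool)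
    (hA : A ∈ Matrix.unitaryGroup E ℂ) (hB : B ∈ Matrix.unitaryGroup E ℂ)
    (lA : IsLocalOn G loc A) (lB : IsLocalOn G loc B) (ρ : E)
    (f : (V → Bool) → Option Bool)
    (hf : ∀ X y, f X = some y →
      if y then 2 / 3 ≤ ∑ e, ‖(1 / (N + 1) : ℂ) * ∑ i ∈ Finset.range (N + 1),
        ((walkMatrix loc A B leaf X ^ i) *ᵥ Pi.single ρ 1) e‖ ^ 2
      else ∑ e, ‖(1 / (N + 1) : ℂ) * ∑ i ∈ Finset.range (N + 1),
        ((walkMatrix loc A B leaf X ^ i) *ᵥ Pi.single ρ 1) e‖ ^ 2 ≤ 1 / 3) :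
    ∃ R : Robot G, R.Evaluates (loc ρ) f (4 * (N + 2)) := by
  refine ⟨(phaseTest N A B leaf hA hB lA lB).robot (ρ, none) fun b => decide (b.2 = some 0),
    fun X y hX => ?_⟩
  have h := hf X y hX
  rw [← phaseTest_prob N A B leaf hA hB lA lB] at h
  rw [(phaseTest N A B leaf hA hB lA lB).robot_outputProb (b₀ := (ρ, none)) rfl]
  cases y
  · have htot := (phaseTest N A B leaf hA hB lA lB).sum_state (ρ, none) X (N + 2)
    rw [← Finset.sum_filter_add_sum_filter_not _
      (fun b : E × Option (Fin (N + 1)) => decide (b.2 = some 0) = true)] at htot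
    simp only [Bool.not_eq_true] at htot
    simp only [Bool.false_eq_true, if_false] at h
    linarith
  · simpa using h

end PhaseTest

end SpatialSearch

namespace SpatialSearch

/-! ### Averages of the iterates of a unitary -/

section Average

variable {E : Type*} [Fintype E] [DecidableEq E]

theorem norm_sub_sq_le (x y : ℂ) : ‖x - y‖ ^ 2 ≤ 2 * ‖x‖ ^ 2 + 2 * ‖y‖ ^ 2 := by
  have h1 := norm_sub_le x y
  nlinarith [sq_nonneg (‖x‖ - ‖y‖), norm_nonneg (x - y), norm_nonneg x, norm_nonneg y]

theorem sum_pow_mulVec_of_coboundary {U : Matrix E E ℂ} {r u : E → ℂ} (h : r = u - U *ᵥ u)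
    (n : ℕ) : ∑ i ∈ Finset.range n, (U ^ i) *ᵥ r = u - (U ^ n) *ᵥ u := by
  induction n with
  | zero => simp
  | succ n ih =>
    rw [Finset.sum_range_succ, ih, h, Matrix.mulVec_sub, pow_succ, Matrix.mulVec_mulVec]
    abel

/-- The averages of the iterates of a coboundary tend to zero. -/
theorem average_sq_le_of_coboundary {U : Matrix E E ℂ} (hU : U ∈ Matrix.unitaryGroup E ℂ)
    {r u : E → ℂ} (h : (2 : ℂ) • r = u - U *ᵥ u) (N : ℕ) :
    ∑ e, ‖(1 / (N + 1) : ℂ) * ∑ i ∈ Finset.range (N + 1), ((U ^ i) *ᵥ r) e‖ ^ 2 ≤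
      (∑ e, ‖u e‖ ^ 2) / (N + 1) ^ 2 := by
  have h1 := sum_pow_mulVec_of_coboundary h (N + 1)
  have h2 : ∀ e, ∑ i ∈ Finset.range (N + 1), ((U ^ i) *ᵥ r) e =
      (1 / 2 : ℂ) * (u e - ((U ^ (N + 1)) *ᵥ u) e) := by
    intro e
    rw [← Pi.sub_apply, ← h1, Finset.sum_apply, Finset.mul_sum]
    refine Finset.sum_congr rfl fun i _ => ?_
    rw [Matrix.mulVec_smul, Pi.smul_apply, smul_eq_mul]
    ring
  have h3 : ‖(1 / (N + 1) : ℂ)‖ = 1 / (N + 1) := by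
    rw [norm_div, norm_one]
    congr 1
    exact_mod_cast Complex.norm_natCast (N + 1)
  have h4 : ∑ e, ‖((U ^ (N + 1)) *ᵥ u) e‖ ^ 2 = ∑ e, ‖u e‖ ^ 2 :=
    sum_norm_sq_unitary_mulVec (pow_mem hU _) u
  calc _ ≤ ∑ e, ((1 / (N + 1 : ℝ)) ^ 2 * (1 / 4) *
        (2 * ‖u e‖ ^ 2 + 2 * ‖((U ^ (N + 1)) *ᵥ u) e‖ ^ 2)) := by
        refine Finset.sum_le_sum fun e _ => ?_
        rw [h2, norm_mul, norm_mul, h3, mul_pow, mul_pow]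
        have : ‖(1 / 2 : ℂ)‖ ^ 2 = 1 / 4 := by norm_num
        rw [this, ← mul_assoc]
        exact mul_le_mul_of_nonneg_left (norm_sub_sq_le _ _) (by positivity)
    _ = _ := by
        rw [← Finset.mul_sum, Finset.sum_add_distrib, ← Finset.mul_sum, ← Finset.mul_sum, h4]
        field_simp
        ring

/-- The averages of the iterates of a basis state retain its component along a fixed vector. -/
theorem le_average_sq_of_fixed {U : Matrix E E ℂ} (hU : U ∈ Matrix.unitaryGroup E ℂ)
    {ρ : E} {ψ : E → ℂ} (h : U *ᵥ ψ = ψ) (hρ : ψ ρ = 1) (N : ℕ) :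
    1 / (∑ e, ‖ψ e‖ ^ 2) ≤
      ∑ e, ‖(1 / (N + 1) : ℂ) * ∑ i ∈ Finset.range (N + 1),
        ((U ^ i) *ᵥ Pi.single ρ 1) e‖ ^ 2 := by
  have h1 : ∀ i : ℕ, star ψ ⬝ᵥ ((U ^ i) *ᵥ Pi.single ρ 1) = 1 := by
    intro i
    have hi : (U ^ i) *ᵥ ψ = ψ := by
      induction i with
      | zero => simp
      | succ i ih => rw [pow_succ, ← Matrix.mulVec_mulVec, h, ih]
    -- A vector fixed by a unitary is fixed by its adjoint, so every iterate, and hence the average,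
    -- keeps overlap 1 with `ψ`. Cauchy–Schwarz then bounds the norm of the average from below.
    have hadj : (U ^ i)ᴴ *ᵥ ψ = ψ := by
      nth_rewrite 1 [← hi]
      rw [Matrix.mulVec_mulVec, ← Matrix.star_eq_conjTranspose,
        Matrix.mem_unitaryGroup_iff'.1 (pow_mem hU i), Matrix.one_mulVec]
    rw [Matrix.dotProduct_mulVec]
    have : star ψ ᵥ* (U ^ i) = star ψ := by
      rw [← Matrix.conjTranspose_conjTranspose (U ^ i), ← Matrix.star_mulVec, hadj]
    rw [this]
    simp [hρ]
  set x : E → ℂ := fun e => (1 / (N + 1) : ℂ) * ∑ i ∈ Finset.range (N + 1),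
    ((U ^ i) *ᵥ Pi.single ρ 1) e with hx
  have h2 : ∑ e, star (ψ e) * x e = 1 := by
    have h3 : ∑ e, star (ψ e) * x e =
        (1 / (N + 1) : ℂ) * ∑ i ∈ Finset.range (N + 1),
          star ψ ⬝ᵥ ((U ^ i) *ᵥ Pi.single ρ 1) := by
      simp only [hx, dotProduct, Finset.mul_sum, Pi.star_apply]
      rw [Finset.sum_comm]
      refine Finset.sum_congr rfl fun i _ => Finset.sum_congr rfl fun e _ => by ring
    rw [h3]
    simp only [h1, Finset.sum_const, Finset.card_range, nsmul_eq_mul, mul_one]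
    push_cast
    have : (N + 1 : ℂ) ≠ 0 := by exact_mod_cast Nat.succ_ne_zero N
    field_simp
  have h4 : (1 : ℝ) ≤ ∑ e, ‖ψ e‖ * ‖x e‖ := by
    calc (1 : ℝ) = ‖∑ e, star (ψ e) * x e‖ := by rw [h2, norm_one]
      _ ≤ ∑ e, ‖star (ψ e) * x e‖ := norm_sum_le _ _
      _ = _ := by simp
  have h5 := Finset.sum_mul_sq_le_sq_mul_sq Finset.univ (fun e => ‖ψ e‖) (fun e => ‖x e‖)
  have h6 : 0 < ∑ e, ‖ψ e‖ ^ 2 := by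
    refine Finset.sum_pos' (fun _ _ => by positivity) ⟨ρ, Finset.mem_univ _, ?_⟩
    simp [hρ]
  rw [div_le_iff₀ h6, mul_comm]
  nlinarith

end Average

/-! ### Walks on layered trees -/

/-- A rooted tree of even height, all of whose leaves are at height `0`, with its nodes at
height `h` named by vertices of `G` (not all names are used: the nodes are the `centres`) and
placed at vertices of `G`, so that the leaves are the vertices of `G` and each node
and its children are placed at one vertex or at two adjacent vertices. -/
structure LayeredTree {V : Type*} [Fintype V] (G : SimpleGraph V) (s : V) where
  height : ℕ
  even_height : height % 2 = 0
  loc : ℕ → V → V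
  parent : ℕ → V → V
  centres : ℕ → Finset V
  loc_zero : ∀ v, loc 0 v = v
  loc_top : loc height s = s
  loc_local : ∀ h c, ∃ u v : V, (u = v ∨ G.Adj u v) ∧
    (loc (h + 1) c = u ∨ loc (h + 1) c = v) ∧
    ∀ c', parent h c' = c → loc h c' = u ∨ loc h c' = v
  centres_zero : centres 0 = Finset.univ
  centres_top : centres height = {s}
  parent_mem : ∀ h < height, ∀ c ∈ centres h, parent h c ∈ centres (h + 1)

namespace LayeredTree

variable {V : Type*} [Fintype V] [DecidableEq V] {G : SimpleGraph V} {s : V}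
  (τ : LayeredTree G s)

/-- The ancestor of a leaf at a given height. -/
def ancestor : ℕ → V → V
  | 0, v => v
  | h + 1, v => τ.parent h (ancestor h v)

theorem ancestor_mem {h : ℕ} (hh : h ≤ τ.height) (v : V) : τ.ancestor h v ∈ τ.centres h := by
  induction h with
  | zero => simp [τ.centres_zero]
  | succ h ih => exact τ.parent_mem h (by omega) _ (ih (by omega))

/-- The edges: `(h, c)` stands for the edge from the node `c` at height `h` to its parent. At the
root this is a dangling edge. -/
abbrev Edge : Type _ := Fin (τ.height + 1) × V

/-- The end of an edge whose height has the parity of `p`. -/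
def endpoint (p : ℕ) (e : τ.Edge) : ℕ × V :=
  if (e.1 : ℕ) % 2 = p then (e.1, e.2) else (e.1 + 1, τ.parent e.1 e.2)

/-- The vertex at which an edge is placed. -/
def edgeLoc (e : τ.Edge) : V := τ.loc e.1 e.2

/-- The edge dangling from the root. -/
def root : τ.Edge := (Fin.last _, s)

/-- An edge is placed at its lower end, so the star of a node occupies the places of the node and of
its children. This makes the reflections C-local. -/
theorem endpoint_local (p : ℕ) (e : τ.Edge) : ∃ u v : V, (u = v ∨ G.Adj u v) ∧
    ∀ e', τ.endpoint p e' = τ.endpoint p e → τ.edgeLoc e' = u ∨ τ.edgeLoc e' = v := by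
  rcases hm : τ.endpoint p e with ⟨m, c⟩
  cases m with
  | zero =>
    refine ⟨τ.loc 0 c, τ.loc 0 c, Or.inl rfl, fun e' he' => ?_⟩
    unfold endpoint at he'
    split_ifs at he' with h1
    · simp only [Prod.mk.injEq] at he'
      simp [edgeLoc, he'.1, he'.2]
    · simp at he'
  | succ h =>
    obtain ⟨u, v, huv, h1, h2⟩ := τ.loc_local h c
    refine ⟨u, v, huv, fun e' he' => ?_⟩
    unfold endpoint at he'
    split_ifs at he' with h3
    · simp only [Prod.mk.injEq] at he'
      rw [edgeLoc, he'.1, he'.2]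
      exact h1
    · simp only [Prod.mk.injEq, Nat.add_right_cancel_iff] at he'
      rw [edgeLoc, he'.1]
      exact h2 _ (he'.1 ▸ he'.2)

theorem sum_endpoint_succ {p h : ℕ} (hh : h + 1 ≤ τ.height) (hp : (h + 1) % 2 = p) (c : V)
    (F : ℕ → V → ℂ) :
    ∑ e with τ.endpoint p e = (h + 1, c), F e.1 e.2 =
      F (h + 1) c + ∑ c' with τ.parent h c' = c, F h c' := by
  rw [Finset.sum_filter, Fintype.sum_prod_type]
  rw [Finset.sum_eq_add (⟨h + 1, by omega⟩ : Fin (τ.height + 1)) (⟨h, by omega⟩)]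
  · congr 1
    · rw [Finset.sum_eq_single c] <;> simp +contextual [endpoint, hp]
    · rw [Finset.sum_filter]
      refine Finset.sum_congr rfl fun c' _ => ?_
      have : h % 2 ≠ p := by omega
      simp [endpoint, this]
  · simp
  · rintro i - ⟨h1, h2⟩
    refine Finset.sum_eq_zero fun c' _ => if_neg fun h3 => ?_
    unfold endpoint at h3
    split_ifs at h3 <;> simp only [Prod.mk.injEq, Nat.add_right_cancel_iff] at h3
    · exact h1 (Fin.ext h3.1)
    · exact h2 (Fin.ext h3.1)
  · simp
  · simp

/-! ### The weighted walk and the flow to the marked leaves -/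

section Walk

variable (w : ℕ → ℝ)

/-- The vector of the square roots of the weights of the edges. -/
noncomputable def sqrtWeight (h : ℕ) (c : V) : ℝ :=
  if c ∈ τ.centres h then Real.sqrt (w h) else 0

/-- The weights without that of the dangling edge. -/
noncomputable def innerWeight (h : ℕ) (c : V) : ℝ :=
  if h = τ.height then 0 else τ.sqrtWeight w h c

/-- The reflections at the nodes of even height. -/
noncomputable def evenStep : Matrix τ.Edge τ.Edge ℂ :=
  fibreReflection (τ.endpoint 0) fun e => τ.sqrtWeight w e.1 e.2

/-- The reflections at the nodes of odd height. -/
noncomputable def oddStep : Matrix τ.Edge τ.Edge ℂ :=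
  fibreReflection (τ.endpoint 1) fun e => τ.innerWeight w e.1 e.2

/-- The edges at the leaves. -/
def isLeaf (e : τ.Edge) : Bool := decide ((e.1 : ℕ) = 0)

/-- The step of the quantum walk on the tree that leaves out the reflections at marked leaves. -/
noncomputable def walk (X : V → Bool) : Matrix τ.Edge τ.Edge ℂ :=
  walkMatrix τ.edgeLoc (τ.evenStep w) (τ.oddStep w) τ.isLeaf X

theorem walk_unitary (X : V → Bool) : τ.walk w X ∈ Matrix.unitaryGroup τ.Edge ℂ := by
  refine mul_mem (mul_mem (fibreReflection_unitary _ _) ?_) (fibreReflection_unitary _ _)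
  rw [Matrix.mem_unitaryGroup_iff, Matrix.star_eq_conjTranspose,
    Matrix.diagonal_conjTranspose, Matrix.diagonal_mul_diagonal, ← Matrix.diagonal_one]
  congr 1
  funext e
  simp only [Pi.star_apply]
  split_ifs <;> simp

theorem walk_mulVec (X : V → Bool) (f : τ.Edge → ℂ) :
    τ.walk w X *ᵥ f = τ.oddStep w *ᵥ fun e =>
      (if τ.isLeaf e && X (τ.edgeLoc e) then -1 else 1) * (τ.evenStep w *ᵥ f) e := by
  rw [walk, walkMatrix, ← Matrix.mulVec_mulVec, ← Matrix.mulVec_mulVec]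
  congr 1
  funext e
  rw [Matrix.mulVec_diagonal]

theorem sqrtWeight_top (hw : w τ.height = 1) (c : V) :
    τ.sqrtWeight w τ.height c = if c = s then 1 else 0 := by
  simp [sqrtWeight, τ.centres_top, hw]

/-- Without marked vertices, the dangling edge is a coboundary. -/
theorem two_smul_root (hw : w τ.height = 1) {X : V → Bool} (hX : ∀ v, X v = false) :
    (2 : ℂ) • (Pi.single τ.root 1 : τ.Edge → ℂ) =
      (fun e => (τ.sqrtWeight w e.1 e.2 : ℂ)) -
        τ.walk w X *ᵥ fun e => (τ.sqrtWeight w e.1 e.2 : ℂ) := by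
  -- Write u = δ + v, with v the inner weights. The even reflections negate u; the odd ones fix δ,
  -- where the inner weight is 0, and negate v. So u is sent to -δ + v.
  have h1 : (fun e : τ.Edge => (τ.sqrtWeight w e.1 e.2 : ℂ)) =
      Pi.single τ.root 1 + fun e => (τ.innerWeight w e.1 e.2 : ℂ) := by
    funext ⟨h, c⟩
    simp only [Pi.add_apply, innerWeight]
    by_cases hh : (h : ℕ) = τ.height
    · have h2 : h = Fin.last τ.height := Fin.ext hh
      subst h2
      by_cases hc : c = s <;> simp [τ.sqrtWeight_top w hw, root, hc]
    · have h2 : h ≠ Fin.last τ.height := fun h' => hh (by simp [h'])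
      simp [hh, root, h2]
  have h2 : τ.oddStep w *ᵥ Pi.single τ.root 1 = Pi.single τ.root 1 := by
    funext e
    refine fibreReflection_mulVec_of_orthogonal (Or.inr (Finset.sum_eq_zero fun e' _ => ?_))
    by_cases he : e' = τ.root
    · simp [he, root, innerWeight]
    · simp [he]
  rw [walk_mulVec]
  simp only [hX, Bool.and_false, Bool.false_eq_true, if_false, one_mul]
  have h3 : (τ.evenStep w *ᵥ fun e => (τ.sqrtWeight w e.1 e.2 : ℂ)) =
      -Pi.single τ.root 1 - fun e => (τ.innerWeight w e.1 e.2 : ℂ) := by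
    refine (fibreReflection_mulVec_self _ _).trans ?_
    funext e
    have := congrFun h1 e
    simp only [Pi.add_apply] at this
    simp only [this, Pi.sub_apply, Pi.neg_apply]
    ring
  have h4 : (τ.oddStep w *ᵥ fun e => (τ.innerWeight w e.1 e.2 : ℂ)) =
      -fun e => (τ.innerWeight w e.1 e.2 : ℂ) := fibreReflection_mulVec_self _ _
  have h5 : (fun e => (τ.evenStep w *ᵥ fun e => (τ.sqrtWeight w e.1 e.2 : ℂ)) e) =
    τ.evenStep w *ᵥ fun e => (τ.sqrtWeight w e.1 e.2 : ℂ) := rfl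
  rw [h5, h3, Matrix.mulVec_sub, Matrix.mulVec_neg, h2, h4, h1, two_smul]
  abel

/-- The flow from the root to the marked leaves that is uniform on them. -/
noncomputable def flow (X : V → Bool) (h : ℕ) (c : V) : ℝ :=
  ((Finset.univ.filter fun v => X v = true ∧ τ.ancestor h v = c).card : ℝ) / markedCount X

theorem flow_succ (X : V → Bool) (h : ℕ) (c : V) :
    ∑ c' with τ.parent h c' = c, τ.flow X h c' = τ.flow X (h + 1) c := by
  simp only [flow, ← Finset.sum_div]
  congr 1
  rw [← Nat.cast_sum]
  congr 1
  rw [Finset.card_eq_sum_card_fiberwise (f := τ.ancestor h)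
    (t := Finset.univ.filter fun c' => τ.parent h c' = c)]
  · refine Finset.sum_congr rfl fun c' hc' => ?_
    congr 1
    ext v
    have := (Finset.mem_filter.1 hc').2
    rw [Finset.mem_filter, Finset.mem_filter, Finset.mem_filter]
    constructor
    · rintro ⟨h0, h1, rfl⟩
      exact ⟨⟨h0, h1, this⟩, rfl⟩
    · rintro ⟨⟨h0, h1, -⟩, h2⟩
      exact ⟨h0, h1, h2⟩
  · intro v hv
    simpa [ancestor] using (Finset.mem_filter.1 hv).2.2

theorem flow_nonneg (X : V → Bool) (h : ℕ) (c : V) : 0 ≤ τ.flow X h c := by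
  unfold flow
  positivity

theorem sum_flow {X : V → Bool} (hX : markedCount X ≠ 0) (h : ℕ) :
    ∑ c, τ.flow X h c = 1 := by
  simp only [flow, ← Finset.sum_div]
  rw [div_eq_one_iff_eq (by exact_mod_cast hX), ← Nat.cast_sum]
  congr 1
  rw [markedCount, Finset.card_eq_sum_card_fiberwise (f := τ.ancestor h) (t := Finset.univ)
    (by simp)]
  simp only [Finset.filter_filter]

theorem flow_le_one {X : V → Bool} (hX : markedCount X ≠ 0) (h : ℕ) (c : V) :
    τ.flow X h c ≤ 1 := by
  rw [← τ.sum_flow hX h]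
  exact Finset.single_le_sum (fun c _ => τ.flow_nonneg X h c) (Finset.mem_univ c)

theorem flow_eq_zero (X : V → Bool) {h : ℕ} (hh : h ≤ τ.height) {c : V}
    (hc : c ∉ τ.centres h) : τ.flow X h c = 0 := by
  rw [flow, Finset.card_eq_zero.2, Nat.cast_zero, zero_div]
  refine Finset.filter_eq_empty_iff.2 ?_
  rintro v - ⟨-, rfl⟩
  exact hc (τ.ancestor_mem hh v)

theorem flow_top {X : V → Bool} (hX : markedCount X ≠ 0) : τ.flow X τ.height s = 1 := by
  rw [← τ.sum_flow hX τ.height]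
  symm
  refine Finset.sum_eq_single s (fun c _ hc => ?_) (by simp)
  exact τ.flow_eq_zero X le_rfl (by simpa [τ.centres_top] using hc)

/-- The invariant vector of the walk given by the flow. -/
noncomputable def flowVec (X : V → Bool) (h : ℕ) (c : V) : ℂ :=
  (-1) ^ h * ((τ.flow X h c / Real.sqrt (w h) : ℝ) : ℂ)

theorem sqrtWeight_mul_flowVec (hw : ∀ h, 0 < w h) (X : V → Bool) {h : ℕ} (hh : h ≤ τ.height)
    (c : V) : (τ.sqrtWeight w h c : ℂ) * τ.flowVec w X h c = (-1) ^ h * (τ.flow X h c : ℂ) := by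
  unfold sqrtWeight flowVec
  split_ifs with hc
  · have : (Real.sqrt (w h) : ℂ) ≠ 0 := by exact_mod_cast (Real.sqrt_pos.2 (hw h)).ne'
    push_cast
    field_simp
  · simp [τ.flow_eq_zero X hh hc]

/-- Kirchhoff's law: as the sign alternates with height, the flow on the edge to the parent cancels
the flows on the edges to the children. -/
theorem sum_endpoint_flowVec (hw : ∀ h, 0 < w h) (X : V → Bool) {p h : ℕ}
    (hh : h + 1 ≤ τ.height) (hp : (h + 1) % 2 = p) (c : V) :
    ∑ e with τ.endpoint p e = (h + 1, c),
      (τ.sqrtWeight w e.1 e.2 : ℂ) * τ.flowVec w X e.1 e.2 = 0 := by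
  rw [τ.sum_endpoint_succ hh hp c fun h c => (τ.sqrtWeight w h c : ℂ) * τ.flowVec w X h c,
    τ.sqrtWeight_mul_flowVec w hw X hh]
  have h1 : ∑ c' with τ.parent h c' = c, (τ.sqrtWeight w h c' : ℂ) * τ.flowVec w X h c' =
      (-1) ^ h * (τ.flow X (h + 1) c : ℂ) := by
    rw [← τ.flow_succ X h c, Complex.ofReal_sum, Finset.mul_sum]
    exact Finset.sum_congr rfl fun c' _ => τ.sqrtWeight_mul_flowVec w hw X (by omega) c'
  rw [h1, pow_succ]
  ring

/-- Above the leaves this is Kirchhoff's law. The star of a leaf is a single edge, which the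
reflection negates: at a marked leaf this is the sign that the query undoes, and at an unmarked one
the flow is zero. -/
theorem evenStep_flowVec (hw : ∀ h, 0 < w h) (X : V → Bool) (e : τ.Edge) :
    (τ.evenStep w *ᵥ fun e => τ.flowVec w X e.1 e.2) e =
      (if τ.isLeaf e && X (τ.edgeLoc e) then -1 else 1) * τ.flowVec w X e.1 e.2 := by
  obtain ⟨⟨h, hh⟩, c⟩ := e
  rcases Nat.eq_zero_or_pos h with rfl | hpos
  · by_cases hc : X c = true
    · simp only [isLeaf, edgeLoc, decide_true, τ.loc_zero, hc, Bool.and_self, if_true]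
      rw [evenStep, fibreReflection_mulVec]
      have h1 : ∀ e : τ.Edge, τ.endpoint 0 e = τ.endpoint 0 (⟨0, hh⟩, c) ↔ e = (⟨0, hh⟩, c) := by
        rintro ⟨⟨h', hh'⟩, c'⟩
        have h0 : τ.endpoint 0 (⟨0, hh⟩, c) = (0, c) := if_pos rfl
        rw [h0]
        unfold endpoint
        split_ifs with h2
        · simp
        · simp only [Prod.mk.injEq, Nat.succ_ne_zero, false_and, Fin.mk.injEq, false_iff]
          rintro ⟨rfl, -⟩
          exact h2 rfl
      have h2 : c ∈ τ.centres 0 := by simp [τ.centres_zero]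
      have h3 : (Real.sqrt (w 0) : ℂ) ≠ 0 := by exact_mod_cast (Real.sqrt_pos.2 (hw 0)).ne'
      simp only [h1, Finset.filter_eq', Finset.mem_univ, if_true, Finset.sum_singleton,
        sqrtWeight, h2]
      field_simp
      ring
    · have hc' : X c = false := by simpa using hc
      simp only [isLeaf, edgeLoc, decide_true, τ.loc_zero, hc', Bool.and_false,
        Bool.false_eq_true, if_false, one_mul]
      have h0 : τ.flow X 0 c = 0 := by
        rw [flow, Finset.card_eq_zero.2, Nat.cast_zero, zero_div]
        refine Finset.filter_eq_empty_iff.2 ?_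
        rintro v - ⟨h1, rfl⟩
        exact hc h1
      refine fibreReflection_mulVec_of_orthogonal (Or.inr (Finset.sum_eq_zero ?_))
      rintro ⟨⟨h', hh'⟩, c'⟩ he
      have he := (Finset.mem_filter.1 he).2
      have h1 : h' = 0 ∧ c' = c := by
        unfold endpoint at he
        split_ifs at he <;> simp_all
      obtain ⟨rfl, rfl⟩ := h1
      rw [τ.sqrtWeight_mul_flowVec w hw X (Nat.zero_le _), h0]
      simp
  · have h0 : ¬ h = 0 := by omega
    simp only [isLeaf, h0, decide_false, Bool.false_and, Bool.false_eq_true, if_false, one_mul]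
    refine fibreReflection_mulVec_of_orthogonal (Or.inr ?_)
    by_cases hp : h % 2 = 0
    · obtain ⟨h, rfl⟩ : ∃ h', h = h' + 1 := ⟨h - 1, by omega⟩
      have : τ.endpoint 0 (⟨h + 1, hh⟩, c) = (h + 1, c) := if_pos hp
      rw [this]
      exact τ.sum_endpoint_flowVec w hw X (by omega) hp c
    · have : τ.endpoint 0 (⟨h, hh⟩, c) = (h + 1, τ.parent h c) := if_neg hp
      rw [this]
      have := τ.even_height
      exact τ.sum_endpoint_flowVec w hw X (by omega) (by omega) _

/-- The dangling edge would violate Kirchhoff's law at its upper end, but its inner weight is 0, so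
no condition arises there. -/
theorem oddStep_flowVec (hw : ∀ h, 0 < w h) (X : V → Bool) :
    (τ.oddStep w *ᵥ fun e => τ.flowVec w X e.1 e.2) = fun e => τ.flowVec w X e.1 e.2 := by
  funext ⟨⟨h, hh⟩, c⟩
  refine fibreReflection_mulVec_of_orthogonal ?_
  have heven := τ.even_height
  have key : ∀ h c, h + 1 ≤ τ.height → (h + 1) % 2 = 1 →
      ∑ e with τ.endpoint 1 e = (h + 1, c),
        (τ.innerWeight w e.1 e.2 : ℂ) * τ.flowVec w X e.1 e.2 = 0 := by
    intro h c hh hp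
    rw [← τ.sum_endpoint_flowVec w hw X hh hp c]
    refine Finset.sum_congr rfl fun e he => ?_
    have he := (Finset.mem_filter.1 he).2
    have h1 : (e.1 : ℕ) ≠ τ.height := by
      intro h2
      unfold endpoint at he
      split_ifs at he <;> simp only [Prod.mk.injEq] at he <;> omega
    rw [innerWeight, if_neg h1]
  by_cases htop : h = τ.height
  · left
    simp [innerWeight, htop]
  · right
    by_cases hp : h % 2 = 1
    · obtain ⟨h, rfl⟩ : ∃ h', h = h' + 1 := ⟨h - 1, by omega⟩
      have : τ.endpoint 1 (⟨h + 1, hh⟩, c) = (h + 1, c) := if_pos hp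
      rw [this]
      exact key h c (by omega) hp
    · have : τ.endpoint 1 (⟨h, hh⟩, c) = (h + 1, τ.parent h c) := if_neg hp
      rw [this]
      exact key h _ (by omega) (by omega)

theorem walk_flowVec (hw : ∀ h, 0 < w h) (X : V → Bool) :
    (τ.walk w X *ᵥ fun e => τ.flowVec w X e.1 e.2) = fun e => τ.flowVec w X e.1 e.2 := by
  rw [walk_mulVec]
  refine Eq.trans ?_ (τ.oddStep_flowVec w hw X)
  congr 1
  funext e
  rw [τ.evenStep_flowVec w hw X e, ← mul_assoc]
  split_ifs <;> simp

theorem flowVec_root (hw1 : w τ.height = 1) {X : V → Bool} (hX : markedCount X ≠ 0) :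
    τ.flowVec w X τ.root.1 τ.root.2 = 1 := by
  have h1 : (-1 : ℂ) ^ τ.height = 1 := Even.neg_one_pow (Nat.even_iff.2 τ.even_height)
  simp [flowVec, root, τ.flow_top hX, hw1, h1]

theorem sum_norm_sqrtWeight_sq (hw : ∀ h, 0 < w h) :
    ∑ e : τ.Edge, ‖(τ.sqrtWeight w e.1 e.2 : ℂ)‖ ^ 2 =
      ∑ h ∈ Finset.range (τ.height + 1), (τ.centres h).card * w h := by
  rw [Fintype.sum_prod_type, Finset.sum_range]
  refine Finset.sum_congr rfl fun h _ => ?_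
  have h1 : ∀ c, ‖(τ.sqrtWeight w h c : ℂ)‖ ^ 2 = if c ∈ τ.centres h then w h else 0 := by
    intro c
    unfold sqrtWeight
    split_ifs
    · rw [Complex.norm_real, Real.norm_of_nonneg (Real.sqrt_nonneg _), Real.sq_sqrt (hw h).le]
    · simp
  simp only [h1]
  simp

theorem sum_norm_flowVec_sq (hw : ∀ h, 0 < w h) (X : V → Bool) :
    ∑ e : τ.Edge, ‖τ.flowVec w X e.1 e.2‖ ^ 2 =
      ∑ h ∈ Finset.range (τ.height + 1), (∑ c, τ.flow X h c ^ 2) / w h := by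
  rw [Fintype.sum_prod_type, Finset.sum_range]
  refine Finset.sum_congr rfl fun h _ => ?_
  rw [Finset.sum_div]
  refine Finset.sum_congr rfl fun c _ => ?_
  rw [flowVec, norm_mul, norm_pow, norm_neg, norm_one, one_pow, one_mul, Complex.norm_real,
    Real.norm_eq_abs, sq_abs, div_pow, Real.sq_sqrt (hw h).le]

theorem sum_flow_sq_le_one {X : V → Bool} (hX : markedCount X ≠ 0) (h : ℕ) :
    ∑ c, τ.flow X h c ^ 2 ≤ 1 := by
  rw [← τ.sum_flow hX h]
  refine Finset.sum_le_sum fun c _ => ?_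
  nlinarith [τ.flow_nonneg X h c, τ.flow_le_one hX h c]

/-- Before paths merge, each edge carries the flow to at most one leaf. This is the only gain from
having many marked vertices. -/
theorem sum_flow_sq_le_of_ancestor {X : V → Bool} (hX : markedCount X ≠ 0) {h : ℕ}
    (hh : ∀ v, τ.ancestor h v = v) :
    ∑ c, τ.flow X h c ^ 2 ≤ 1 / markedCount X := by
  have h1 : ∀ c, τ.flow X h c ≤ 1 / markedCount X := by
    intro c
    unfold flow
    gcongr
    have : (Finset.univ.filter fun v => X v = true ∧ τ.ancestor h v = c) ⊆ {c} := by
      intro v hv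
      have := (Finset.mem_filter.1 hv).2.2
      simpa [hh] using this
    exact_mod_cast Finset.card_le_card this
  calc _ ≤ ∑ c, 1 / (markedCount X : ℝ) * τ.flow X h c := by
        refine Finset.sum_le_sum fun c _ => ?_
        rw [pow_two]
        exact mul_le_mul_of_nonneg_right (h1 c) (τ.flow_nonneg X h c)
    _ = _ := by rw [← Finset.mul_sum, τ.sum_flow hX, mul_one]

/-- Searching with the quantum walk on a layered tree: if the total weight is at most
`(N + 1) ^ 2 / 3` and the energy of the flows to at least `k` leaves is at most `3 / 2`, then
`4 * (N + 2)` steps suffice. The first `l` layers of the tree do not branch. -/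
theorem queryComplexity_le (hw : ∀ h, 0 < w h) (hw1 : w τ.height = 1) {k l : ℕ} (hk : 1 ≤ k)
    (hl : ∀ h ≤ l, ∀ v, τ.ancestor h v = v) (N : ℕ)
    (hW : 3 * ∑ h ∈ Finset.range (τ.height + 1), (τ.centres h).card * w h ≤ ((N : ℝ) + 1) ^ 2)
    (hR : ∑ h ∈ Finset.range (τ.height + 1), (if h ≤ l then 1 / (k : ℝ) else 1) / w h ≤ 3 / 2) :
    queryComplexity G s (orAtLeast k) ≤ ((4 * (N + 2) : ℕ) : ℕ∞) := by
  have hroot : τ.edgeLoc τ.root = s := by simp [edgeLoc, root, τ.loc_top]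
  refine iInf₂_le (4 * (N + 2)) ?_
  nth_rewrite 1 [← hroot]
  refine exists_robot_of_walk N (τ.evenStep w) (τ.oddStep w) τ.isLeaf
    (fibreReflection_unitary _ _) (fibreReflection_unitary _ _)
    (fibreReflection_local _ _ (τ.endpoint_local 0))
    (fibreReflection_local _ _ (τ.endpoint_local 1)) τ.root _ fun X y hX => ?_
  unfold orAtLeast at hX
  split_ifs at hX with h0 h1
  · obtain rfl : false = y := by simpa using hX
    have hX' : ∀ v, X v = false := by
      intro v
      have := (Finset.filter_eq_empty_iff.1 (Finset.card_eq_zero.1 h0)) (Finset.mem_univ v)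
      simpa using this
    have h2 := average_sq_le_of_coboundary (τ.walk_unitary w X) (τ.two_smul_root w hw1 hX') N
    rw [τ.sum_norm_sqrtWeight_sq w hw] at h2
    simp only [Bool.false_eq_true, if_false]
    refine h2.trans ?_
    rw [div_le_iff₀ (by positivity)]
    linarith
  · obtain rfl : true = y := by simpa using hX
    have h2 := le_average_sq_of_fixed (τ.walk_unitary w X) (τ.walk_flowVec w hw X)
      (τ.flowVec_root w hw1 h0) N
    simp only [if_true]
    refine le_trans ?_ h2
    have h3 : ∑ e : τ.Edge, ‖τ.flowVec w X e.1 e.2‖ ^ 2 ≤ 3 / 2 := by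
      rw [τ.sum_norm_flowVec_sq w hw]
      refine le_trans (Finset.sum_le_sum fun h _ => ?_) hR
      refine div_le_div_of_nonneg_right ?_ (hw h).le
      split_ifs with hh
      · refine (τ.sum_flow_sq_le_of_ancestor h0 (hl h hh)).trans ?_
        have : (0 : ℝ) < k := by exact_mod_cast hk
        exact one_div_le_one_div_of_le this (by exact_mod_cast h1)
      · exact τ.sum_flow_sq_le_one h0 h
    have h4 : 0 < ∑ e : τ.Edge, ‖τ.flowVec w X e.1 e.2‖ ^ 2 := by
      refine Finset.sum_pos' (fun _ _ => by positivity) ⟨τ.root, Finset.mem_univ _, ?_⟩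
      rw [τ.flowVec_root w hw1 h0]
      simp
    rw [le_div_iff₀ h4]
    linarith

end Walk

end LayeredTree

end SpatialSearch

namespace SpatialSearch

/-! ### Packings of balls -/

section Packing

variable {V : Type*} [Fintype V] [DecidableEq V] {G : SimpleGraph V}

theorem mem_ball_iff (hG : G.Connected) (v u : V) (l : ℕ) : u ∈ ball G v l ↔ G.dist v u ≤ l := by
  have h : G.edist v u = (G.dist v u : ℕ∞) :=
    (SimpleGraph.Reachable.coe_dist_eq_edist (hG v u)).symm
  simp only [ball, Set.mem_setOf_eq, h, Nat.cast_le]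

/-- A maximal set of vertices with disjoint balls of radius `r`. -/
theorem exists_packing (hG : G.Connected) (r : ℕ) (m : ℝ)
    (hm : ∀ v, m ≤ ((ball G v r).ncard : ℝ)) :
    ∃ T : Finset V, T.card * m ≤ Fintype.card V ∧ ∀ v, ∃ c ∈ T, G.dist v c ≤ 2 * r := by
  classical
  let P : Finset V → Prop := fun T => ∀ x ∈ T, ∀ y ∈ T, x ≠ y → 2 * r < G.dist x y
  -- Separation beyond 2r keeps the balls disjoint, which bounds the size; maximality forces the
  -- doubled balls to cover.
  obtain ⟨T, hT, hmax⟩ := Finset.exists_max_image (Finset.univ.filter P) Finset.card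
    ⟨∅, by simp [P]⟩
  have hP : P T := (Finset.mem_filter.1 hT).2
  refine ⟨T, ?_, fun v => ?_⟩
  · have hdisj : ∀ x ∈ T, ∀ y ∈ T, x ≠ y →
        Disjoint (ball G x r).toFinset (ball G y r).toFinset := by
      intro x hx y hy hxy
      rw [Finset.disjoint_left]
      intro z hz hz'
      rw [Set.mem_toFinset, mem_ball_iff hG] at hz hz'
      have h1 := hP x hx y hy hxy
      have h2 := hG.dist_triangle (u := x) (v := z) (w := y)
      rw [SimpleGraph.dist_comm] at hz'
      omega
    have h1 := Finset.card_biUnion hdisj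
    have h2 := Finset.card_le_univ (T.biUnion fun x => (ball G x r).toFinset)
    rw [h1] at h2
    calc (T.card : ℝ) * m = ∑ _c ∈ T, m := by simp
      _ ≤ ∑ c ∈ T, ((ball G c r).toFinset.card : ℝ) := by
        refine Finset.sum_le_sum fun c _ => ?_
        rw [← Set.ncard_eq_toFinset_card']
        exact hm c
      _ ≤ _ := by exact_mod_cast h2
  · by_contra! hv
    have hvT : v ∉ T := fun h => by simpa using hv v h
    have h1 : P (insert v T) := by
      intro x hx y hy hxy
      rw [Finset.mem_insert] at hx hy
      rcases hx with rfl | hx <;> rcases hy with rfl | hy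
      · exact absurd rfl hxy
      · exact hv y hy
      · rw [SimpleGraph.dist_comm]
        exact hv x hx
      · exact hP x hx y hy hxy
    have h2 := hmax (insert v T) (by simpa using h1)
    rw [Finset.card_insert_of_notMem hvT] at h2
    omega

end Packing

/-! ### The tree of nearby centres at exponentially growing scales -/

section Scales

/-- The binary length of `h / L` numbers dyadic blocks of heights. Since `2 ^ 0 / 2 = 0` in `ℕ`, the
formula includes the bottom block `h < L`. -/
theorem size_div_eq_iff {L h j : ℕ} (hL : 0 < L) :
    Nat.size (h / L) = j ↔ L * (2 ^ j / 2) ≤ h ∧ h < L * 2 ^ j := by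
  rw [le_antisymm_iff, Nat.size_le, Nat.div_lt_iff_lt_mul hL, mul_comm (2 ^ j) L, and_comm]
  refine and_congr_left fun _ => ?_
  cases j with
  | zero => simp
  | succ j =>
    rw [Nat.succ_le_iff, Nat.lt_size, Nat.le_div_iff_mul_le hL, pow_succ, Nat.mul_div_cancel _
      (by norm_num), mul_comm]

theorem size_div_of_succ_eq {L h j : ℕ} (hL : 0 < L) (h1 : h + 1 = L * 2 ^ j) :
    Nat.size (h / L) = j := by
  rw [size_div_eq_iff hL]
  refine ⟨?_, by omega⟩
  have h2 : 2 ^ j / 2 < 2 ^ j := Nat.div_lt_self (by positivity) (by norm_num)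
  have h3 := Nat.mul_lt_mul_of_pos_left h2 hL
  omega

theorem size_mul_two_pow_div {L j : ℕ} (hL : 0 < L) : Nat.size (L * 2 ^ j / L) = j + 1 := by
  rw [Nat.mul_div_cancel_left _ hL, Nat.size_pow]

theorem size_succ_div {L h : ℕ} (hL : 0 < L) (h1 : h + 1 ≠ L * 2 ^ Nat.size (h / L)) :
    Nat.size ((h + 1) / L) = Nat.size (h / L) := by
  have h2 := (size_div_eq_iff (j := Nat.size (h / L)) hL).1 rfl
  rw [size_div_eq_iff hL]
  omega

variable {V : Type*} [Fintype V] [DecidableEq V] {G : SimpleGraph V}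

/-- The tree in which the nodes of heights `8 r 2 ^ j` up to `8 r 2 ^ (j + 1)` are the elements
of `T j`. -/
noncomputable def scaleTree (s : V) (r J : ℕ) (hr : 1 ≤ r) (T : ℕ → Finset V)
    (hT : T J = {s}) (p : ℕ → V → V) (hp : ∀ j v, p j v ∈ T j)
    (path : ∀ j v, G.Walk v (p j v)) (hpath : ∀ j v, (path j v).length ≤ 2 * (r * 2 ^ j)) :
    LayeredTree G s where
  height := 8 * r * 2 ^ J
  even_height := by
    rw [show 8 * r * 2 ^ J = 2 * (4 * r * 2 ^ J) by ring, Nat.mul_mod_right]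
  loc h c := if 8 * r * 2 ^ J ≤ h then c else
    (path (Nat.size (h / (8 * r))) c).getVert (h - 8 * r * (2 ^ Nat.size (h / (8 * r)) / 2))
  parent h c := if h < 8 * r * 2 ^ J ∧ h + 1 = 8 * r * 2 ^ Nat.size (h / (8 * r)) then
    p (Nat.size (h / (8 * r))) c else c
  centres h := if h / (8 * r) = 0 then Finset.univ else T (Nat.size (h / (8 * r)) - 1)
  loc_zero v := by
    have : ¬ 8 * r * 2 ^ J ≤ 0 := by
      have := Nat.two_pow_pos J
      rw [not_le]
      positivity
    rw [if_neg this]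
    simp
  loc_top := if_pos le_rfl
  loc_local h c := by
    have hL : 0 < 8 * r := by omega
    by_cases h1 : 8 * r * 2 ^ J ≤ h
    · refine ⟨c, c, Or.inl rfl, ?_⟩
      rw [if_pos (by omega)]
      refine ⟨Or.inl rfl, fun c' hc' => ?_⟩
      rw [if_neg (by omega)] at hc'
      rw [if_pos h1]
      exact Or.inl hc'
    by_cases h2 : h + 1 = 8 * r * 2 ^ Nat.size (h / (8 * r))
    · refine ⟨c, c, Or.inl rfl, ?_, fun c' hc' => ?_⟩
      · split_ifs with h3
        · exact Or.inl rfl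
        · rw [h2, size_mul_two_pow_div hL, pow_succ, Nat.mul_div_cancel _ (by norm_num),
            Nat.sub_self]
          simp
      · rw [if_neg h1]
        rw [if_pos ⟨by omega, h2⟩] at hc'
        rw [SimpleGraph.Walk.getVert_of_length_le]
        · exact Or.inl hc'
        -- Block j has 8r layers if j = 0 and 4r2^j otherwise, while the path has length at most
        -- 2r2^j. So it has reached its end by the last layer, where the branches merge.
        · refine (hpath _ _).trans ?_
          generalize Nat.size (h / (8 * r)) = j at h2
          cases j with
          | zero => simp at h2 ⊢; omega
          | succ j =>
            rw [pow_succ, Nat.mul_div_cancel _ (by norm_num)]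
            rw [pow_succ] at h2
            have : 0 < r * 2 ^ j := by positivity
            have e1 : 8 * r * (2 ^ j * 2) = 16 * (r * 2 ^ j) := by ring
            have e2 : 8 * r * 2 ^ j = 8 * (r * 2 ^ j) := by ring
            have e3 : 2 * (r * (2 ^ j * 2)) = 4 * (r * 2 ^ j) := by ring
            omega
    · have h3 : ¬ 8 * r * 2 ^ J ≤ h + 1 := by
        intro h3
        have h4 : h + 1 = 8 * r * 2 ^ J := by omega
        rw [size_div_of_succ_eq hL h4] at h2
        exact h2 h4
      have h4 := size_succ_div hL h2
      have h5 := ((size_div_eq_iff (j := Nat.size (h / (8 * r))) hL).1 rfl).1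
      simp only [if_neg h1, if_neg h3]
      generalize Nat.size ((h + 1) / (8 * r)) = m at h4 ⊢
      subst h4
      refine ⟨(path (Nat.size (h / (8 * r))) c).getVert
          (h - 8 * r * (2 ^ Nat.size (h / (8 * r)) / 2)), _, ?_, Or.inr rfl, fun c' hc' => ?_⟩
      · rw [show h + 1 - 8 * r * (2 ^ Nat.size (h / (8 * r)) / 2) =
          h - 8 * r * (2 ^ Nat.size (h / (8 * r)) / 2) + 1 by omega]
        by_cases h6 : h - 8 * r * (2 ^ Nat.size (h / (8 * r)) / 2) <
            (path (Nat.size (h / (8 * r))) c).length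
        · exact Or.inr (SimpleGraph.Walk.adj_getVert_succ _ h6)
        · left
          rw [SimpleGraph.Walk.getVert_of_length_le _ (by omega),
            SimpleGraph.Walk.getVert_of_length_le _ (by omega)]
      · rw [if_neg (fun h' : _ ∧ _ => h2 h'.2)] at hc'
        subst hc'
        exact Or.inl rfl
  centres_zero := by simp
  centres_top := by
    have hL : 0 < 8 * r := by omega
    rw [size_mul_two_pow_div hL, Nat.mul_div_cancel_left _ hL, if_neg (by positivity),
      Nat.add_sub_cancel, hT]
  parent_mem h hh c hc := by
    have hL : 0 < 8 * r := by omega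
    by_cases h2 : h + 1 = 8 * r * 2 ^ Nat.size (h / (8 * r))
    · have h3 : Nat.size ((h + 1) / (8 * r)) = Nat.size (h / (8 * r)) + 1 := by
        conv_lhs => rw [h2]
        exact size_mul_two_pow_div hL
      have h4 : (h + 1) / (8 * r) ≠ 0 := fun h' => by simp [h'] at h3
      rw [if_neg h4, if_pos ⟨hh, h2⟩, h3, Nat.add_sub_cancel]
      exact hp _ _
    · have h3 := size_succ_div hL h2
      have h4 : (h + 1) / (8 * r) = 0 ↔ h / (8 * r) = 0 := by
        rw [← Nat.size_eq_zero, h3, Nat.size_eq_zero]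
      rw [if_neg (fun h' : _ ∧ _ => h2 h'.2)]
      simp only [h3, h4]
      exact hc

/-- The trees on which to search a graph with large balls. -/
theorem exists_layeredTree (hG : G.Connected) (s : V) {d κ : ℝ} (hd : 0 < d) (hκ : 0 < κ)
    (hball : ∀ (v : V) (l : ℕ),
      min (κ * (l : ℝ) ^ d) (Fintype.card V : ℝ) ≤ ((ball G v l).ncard : ℝ))
    (r : ℕ) (hr : 1 ≤ r) :
    ∃ (τ : LayeredTree G s) (J : ℕ), τ.height = 8 * r * 2 ^ J ∧
      (∀ h ≤ 8 * r - 1, ∀ v, τ.ancestor h v = v) ∧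
      ∀ h < τ.height, h / (8 * r) ≠ 0 →
        (τ.centres h).card * (κ * (r * ((h / (8 * r) : ℕ) / 2 : ℝ)) ^ d) ≤ Fintype.card V := by
  classical
  have hr0 : (0 : ℝ) < r := by exact_mod_cast hr
  have hex : ∃ J : ℕ, (Fintype.card V : ℝ) ≤ κ * ((r * 2 ^ J : ℕ) : ℝ) ^ d := by
    have h1 : Filter.Tendsto (fun J : ℕ => κ * (((r * 2 ^ J : ℕ) : ℝ)) ^ d) Filter.atTop
        Filter.atTop := by
      refine Filter.Tendsto.const_mul_atTop hκ ((tendsto_rpow_atTop hd).comp ?_)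
      push_cast
      exact (tendsto_pow_atTop_atTop_of_one_lt (by norm_num)).const_mul_atTop hr0
    exact (h1.eventually_ge_atTop _).exists
  -- The first scale at which the lower bound forces every ball to be the whole graph; from there on
  -- `s` alone is a covering.
  let J := Nat.find hex
  have hJ : ∀ j, J ≤ j → (Fintype.card V : ℝ) ≤ κ * ((r * 2 ^ j : ℕ) : ℝ) ^ d := by
    intro j hj
    refine (Nat.find_spec hex).trans ?_
    gcongr
    norm_num
  have hlt : ∀ j < J, κ * ((r * 2 ^ j : ℕ) : ℝ) ^ d < Fintype.card V := fun j hj =>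
    not_le.1 (Nat.find_min hex hj)
  have hcover : ∀ j, ∃ T : Finset V, (J ≤ j → T = {s}) ∧
      (j < J → T.card * (κ * ((r * 2 ^ j : ℕ) : ℝ) ^ d) ≤ Fintype.card V) ∧
      ∀ v, ∃ c ∈ T, G.dist v c ≤ 2 * (r * 2 ^ j) := by
    intro j
    by_cases hj : j < J
    · obtain ⟨T, hT1, hT2⟩ := exists_packing hG (r * 2 ^ j) _ fun v =>
        (min_eq_left (hlt j hj).le).symm.le.trans (hball v (r * 2 ^ j))
      exact ⟨T, fun h => absurd h (by omega), fun _ => hT1, hT2⟩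
    · refine ⟨{s}, fun _ => rfl, fun h => absurd h hj, fun v => ⟨s, by simp, ?_⟩⟩
      have h1 := hball v (r * 2 ^ j)
      rw [min_eq_right (hJ j (by omega))] at h1
      have h2 : ball G v (r * 2 ^ j) = Set.univ := by
        refine Set.eq_of_subset_of_ncard_le (Set.subset_univ _) ?_
        rw [Set.ncard_univ, Nat.card_eq_fintype_card]
        exact_mod_cast h1
      have h3 : s ∈ ball G v (r * 2 ^ j) := h2 ▸ Set.mem_univ s
      rw [mem_ball_iff hG] at h3
      omega
  choose T hTtop hTcard hTcover using hcover
  choose p hp hdist using hTcover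
  have hpath : ∀ j v, ∃ q : G.Walk v (p j v), q.length ≤ 2 * (r * 2 ^ j) := by
    intro j v
    obtain ⟨q, hq⟩ := hG.exists_walk_length_eq_dist v (p j v)
    exact ⟨q, hq ▸ hdist j v⟩
  choose path hpath using hpath
  have hL : 0 < 8 * r := by omega
  refine ⟨scaleTree s r J hr T (hTtop J le_rfl) p hp path hpath, J, rfl, fun h hh v => ?_,
    fun h hh hq => ?_⟩
  · induction h with
    | zero => rfl
    | succ h ih =>
      rw [LayeredTree.ancestor, ih (by omega)]
      refine if_neg fun h1 => ?_
      rw [Nat.div_eq_of_lt (by omega)] at h1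
      simp at h1
      omega
  · have hc : (scaleTree s r J hr T (hTtop J le_rfl) p hp path hpath).centres h =
        T (Nat.size (h / (8 * r)) - 1) := if_neg hq
    have hh' : h < 8 * r * 2 ^ J := hh
    rw [hc]
    obtain ⟨j, hj⟩ : ∃ j, Nat.size (h / (8 * r)) = j + 1 :=
      Nat.exists_eq_succ_of_ne_zero fun h => hq (Nat.size_eq_zero.1 h)
    have h1 : h / (8 * r) < 2 ^ (j + 1) := Nat.size_le.1 hj.le
    have h2 : 2 ^ j ≤ h / (8 * r) := Nat.lt_size.1 (by omega)
    have h3 : h / (8 * r) < 2 ^ J := by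
      rw [Nat.div_lt_iff_lt_mul hL, mul_comm]
      exact hh'
    have h4 : j < J := (Nat.pow_lt_pow_iff_right (by norm_num)).1 (h2.trans_lt h3)
    rw [hj, Nat.add_sub_cancel]
    refine le_trans ?_ (hTcard j h4)
    have h5 : ((h / (8 * r) : ℕ) / 2 : ℝ) ≤ 2 ^ j := by
      have : ((h / (8 * r) : ℕ) : ℝ) ≤ ((2 ^ (j + 1) : ℕ) : ℝ) := by exact_mod_cast h1.le
      rw [pow_succ] at this
      push_cast at this
      linarith
    push_cast
    gcongr

end Scales

end SpatialSearch

namespace SpatialSearch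

/-! ### The choice of the weights -/

section Weights

theorem sum_range_mul_div {M : Type*} [Semiring M] (F : ℕ → M) {L : ℕ} (hL : 0 < L) (Q : ℕ) :
    ∑ h ∈ Finset.range (L * Q), F (h / L) = L * ∑ q ∈ Finset.range Q, F q := by
  induction Q with
  | zero => simp
  | succ Q ih =>
    rw [Nat.mul_succ, Finset.sum_range_add, ih, Finset.sum_range_succ, mul_add]
    congr 1
    rw [← nsmul_eq_mul, ← Finset.card_range L, ← Finset.sum_const, Finset.card_range]
    refine Finset.sum_congr rfl fun x hx => ?_
    rw [Nat.mul_add_div hL, Nat.div_eq_of_lt (Finset.mem_range.1 hx), add_zero]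

/-- The value at `α` of the Riemann zeta function. -/
noncomputable def zetaSum (α : ℝ) : ℝ := ∑' q : ℕ, (q : ℝ) ^ (-α)

theorem zetaSum_nonneg (α : ℝ) : 0 ≤ zetaSum α :=
  tsum_nonneg fun _ => Real.rpow_nonneg (Nat.cast_nonneg _) _

/-- The bound is uniform in the number of scales because the series converges. As `0 ^ (-α) = 0`,
the bottom group contributes just `A`. -/
theorem sum_scales_le {α : ℝ} (hα : 1 < α) {A B : ℝ} (hA : 0 ≤ A) (hB : 0 ≤ B) {L : ℕ}
    (hL : 0 < L) (Q : ℕ) :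
    ∑ h ∈ Finset.range (L * Q),
      ((if h / L = 0 then A else 0) + B * ((h / L : ℕ) : ℝ) ^ (-α)) ≤ L * (A + B * zetaSum α) := by
  rw [sum_range_mul_div (fun q => (if q = 0 then A else 0) + B * (q : ℝ) ^ (-α)) hL]
  refine mul_le_mul_of_nonneg_left ?_ (Nat.cast_nonneg _)
  rw [Finset.sum_add_distrib, ← Finset.mul_sum]
  refine add_le_add ?_ (mul_le_mul_of_nonneg_left ?_ hB)
  · rw [Finset.sum_ite_eq' (Finset.range Q) 0 fun _ => A]
    split_ifs
    · exact le_rfl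
    · exact hA
  · refine Summable.sum_le_tsum _ (fun q _ => Real.rpow_nonneg (Nat.cast_nonneg _) _) ?_
    exact Real.summable_nat_rpow.2 (by linarith)

variable {V : Type*} [Fintype V] [DecidableEq V] {G : SimpleGraph V}

theorem queryComplexity_le_of_ball (hG : G.Connected) (s : V) {d κ : ℝ} (hd : 2 < d) (hκ : 0 < κ)
    (hball : ∀ (v : V) (l : ℕ),
      min (κ * (l : ℝ) ^ d) (Fintype.card V : ℝ) ≤ ((ball G v l).ncard : ℝ))
    {r k : ℕ} (hr : 1 ≤ r) (hk : 1 ≤ k) (hkr : (k : ℝ) ≤ (r : ℝ) ^ d) (N : ℕ)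
    (hN : 3 * (128 * (1 + zetaSum (d / 2)) * (1 + 2 ^ d * zetaSum (d / 2) / κ) *
      (r ^ 2 * Fintype.card V / k) + 1) ≤ ((N : ℝ) + 1) ^ 2) :
    queryComplexity G s (orAtLeast k) ≤ ((4 * (N + 2) : ℕ) : ℕ∞) := by
  obtain ⟨τ, J, hheight, hanc, hcard⟩ := exists_layeredTree hG s (by linarith) hκ hball r hr
  set n : ℝ := ((Fintype.card V : ℕ) : ℝ) with hn
  set Z : ℝ := zetaSum (d / 2) with hZ
  have hZ0 : 0 ≤ Z := zetaSum_nonneg _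
  have hr0 : (0 : ℝ) < r := by exact_mod_cast hr
  have hk0 : (0 : ℝ) < k := by exact_mod_cast hk
  have hn0 : 0 ≤ n := Nat.cast_nonneg _
  have hL : 0 < 8 * r := by omega
  have hα : 1 < d / 2 := by linarith
  -- Chosen to make the energy below the dangling edge at most 1/2; the dangling edge adds 1.
  set w₀ : ℝ := 2 * (8 * r) * (1 + Z) with hw₀
  have hw₀0 : 0 < w₀ := by positivity
  have hrd : (0 : ℝ) < (r : ℝ) ^ d := Real.rpow_pos_of_pos hr0 d
  have hLcast : ((8 * r : ℕ) : ℝ) = 8 * r := by push_cast; ring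
  -- The exponent d/2 splits the decay q^(-d) of the number of centres evenly between total weight
  -- and energy.
  let w : ℕ → ℝ := fun h => if h = τ.height then 1 else
    if h / (8 * r) = 0 then w₀ / k else w₀ * ((h / (8 * r) : ℕ) : ℝ) ^ (d / 2)
  have hq0 : ∀ q : ℕ, q ≠ 0 → (0 : ℝ) < (q : ℝ) := fun q hq => by
    exact_mod_cast Nat.pos_of_ne_zero hq
  have hw : ∀ h, 0 < w h := by
    intro h
    simp only [w]
    split_ifs with h1 h2
    · exact one_pos
    · positivity
    · exact mul_pos hw₀0 (Real.rpow_pos_of_pos (hq0 _ h2) _)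
  have hw1 : w τ.height = 1 := if_pos rfl
  refine τ.queryComplexity_le w hw hw1 hk hanc N ?_ ?_
  · refine le_trans (mul_le_mul_of_nonneg_left ?_ (by norm_num)) hN
    rw [Finset.sum_range_succ, hw1, τ.centres_top, Finset.card_singleton]
    simp only [Nat.cast_one, mul_one]
    refine add_le_add_left ?_ _
    calc _ ≤ ∑ h ∈ Finset.range (8 * r * 2 ^ J), ((if h / (8 * r) = 0 then n * w₀ / k else 0) +
          (n * w₀ * 2 ^ d / (κ * r ^ d)) * ((h / (8 * r) : ℕ) : ℝ) ^ (-(d / 2))) := by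
          rw [hheight]
          refine Finset.sum_le_sum fun h hh => ?_
          have hh' : h < τ.height := by rw [hheight]; exact Finset.mem_range.1 hh
          simp only [w, if_neg hh'.ne]
          split_ifs with h1
          · have h2 : ((τ.centres h).card : ℝ) ≤ n :=
              Nat.cast_le.2 (Finset.card_le_univ (τ.centres h))
            rw [h1, Nat.cast_zero, Real.zero_rpow (by linarith), mul_zero, add_zero,
              mul_div_assoc n w₀]
            exact mul_le_mul_of_nonneg_right h2 (div_pos hw₀0 hk0).le
          · have h2 := hcard h hh' h1
            set q : ℝ := ((h / (8 * r) : ℕ) : ℝ)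
            have hq : 0 < q := hq0 _ h1
            rw [Real.mul_rpow hr0.le (by positivity), Real.div_rpow hq.le (by norm_num)] at h2
            have h3 : q ^ d = q ^ (d / 2) * q ^ (d / 2) := by
              rw [← Real.rpow_add hq]
              congr 1
              ring
            have h4 : 0 < q ^ (d / 2) := Real.rpow_pos_of_pos hq _
            have h5 : (0 : ℝ) < 2 ^ d := Real.rpow_pos_of_pos (by norm_num) _
            rw [Real.rpow_neg hq.le, zero_add, ← div_eq_mul_inv, div_div,
              le_div_iff₀ (by positivity)]
            rw [h3] at h2
            have h6 := mul_le_mul_of_nonneg_right h2 (mul_pos hw₀0 h5).le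
            calc _ = (τ.centres h).card * (κ * (r ^ d * (q ^ (d / 2) * q ^ (d / 2) / 2 ^ d))) *
                  (w₀ * 2 ^ d) := by
                  field_simp
              _ ≤ _ := h6
              _ = _ := by ring
      _ ≤ (8 * r : ℕ) * (n * w₀ / k + (n * w₀ * 2 ^ d / (κ * r ^ d)) * Z) :=
          sum_scales_le hα (by positivity) (by positivity) hL _
      -- Here `k ≤ r ^ d` makes the upper layers cost no more than a constant times the bottom ones.
      _ ≤ (8 * r : ℕ) * (n * w₀ / k + (n * w₀ * 2 ^ d / (κ * k)) * Z) := by gcongr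
      _ = _ := by
          rw [hLcast, hw₀]
          field_simp
          ring
  · rw [Finset.sum_range_succ, hw1]
    have h1 : ¬ τ.height ≤ 8 * r - 1 := by
      rw [hheight, not_le]
      have := Nat.le_mul_of_pos_right (8 * r) (Nat.two_pow_pos J)
      omega
    rw [if_neg h1, div_one, hheight]
    have h2 : ∑ h ∈ Finset.range (8 * r * 2 ^ J),
        (if h ≤ 8 * r - 1 then 1 / (k : ℝ) else 1) / w h ≤ 1 / 2 := by
      calc _ ≤ ∑ h ∈ Finset.range (8 * r * 2 ^ J), ((if h / (8 * r) = 0 then 1 / w₀ else 0) +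
            (1 / w₀) * ((h / (8 * r) : ℕ) : ℝ) ^ (-(d / 2))) := by
            refine Finset.sum_le_sum fun h hh => ?_
            have hh' : h < τ.height := by rw [hheight]; exact Finset.mem_range.1 hh
            have hiff : h ≤ 8 * r - 1 ↔ h / (8 * r) = 0 := by
              rw [Nat.div_eq_zero_iff]
              omega
            simp only [w, if_neg hh'.ne, hiff]
            split_ifs with h1
            · rw [h1, Nat.cast_zero, Real.zero_rpow (by linarith), mul_zero, add_zero]
              apply le_of_eq
              field_simp
            · rw [Real.rpow_neg (Nat.cast_nonneg _), zero_add, one_div_mul_eq_div,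
                inv_eq_one_div, div_div, mul_comm]
        _ ≤ (8 * r : ℕ) * (1 / w₀ + (1 / w₀) * Z) :=
            sum_scales_le hα (by positivity) (by positivity) hL _
        _ = 1 / 2 := by
            rw [hLcast, hw₀]
            have : 1 + Z ≠ 0 := by positivity
            field_simp
    linarith

end Weights

/-- Searching a graph with large balls, with an explicit dependence on `n` and `k`. -/
theorem exists_queryComplexity_le {d κ : ℝ} (hd : 2 < d) (hκ : 0 < κ) :
    ∃ C : ℝ, ∀ {V : Type*} [Fintype V] [DecidableEq V] (G : SimpleGraph V) (s : V) (k : ℕ),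
      G.Connected →
      (∀ (v : V) (l : ℕ),
        min (κ * (l : ℝ) ^ d) (Fintype.card V : ℝ) ≤ ((ball G v l).ncard : ℝ)) →
      1 ≤ k → k ≤ Fintype.card V →
      ((queryComplexity G s (orAtLeast k) : ℕ∞) : ℝ≥0∞) ≤
        ENNReal.ofReal (C * (Real.sqrt (Fintype.card V) / (k : ℝ) ^ (1 / 2 - 1 / d : ℝ))) := by
  set K : ℝ := 128 * (1 + zetaSum (d / 2)) * (1 + 2 ^ d * zetaSum (d / 2) / κ) with hK
  have hK0 : 0 ≤ K := by
    have := zetaSum_nonneg (d / 2)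
    have h2 : (0 : ℝ) < 2 ^ d := Real.rpow_pos_of_pos (by norm_num) _
    positivity
  refine ⟨4 * (Real.sqrt (3 * (K * 4 + 1)) + 3), fun {V} _ _ G s k hG hball hk hkn => ?_⟩
  have hd0 : 0 < d := by linarith
  have hk1 : (1 : ℝ) ≤ k := by exact_mod_cast hk
  have hk0 : (0 : ℝ) < k := by linarith
  have hkn' : (k : ℝ) ≤ Fintype.card V := by exact_mod_cast hkn
  set n : ℝ := ((Fintype.card V : ℕ) : ℝ) with hn
  have hn0 : 0 < n := hk0.trans_le hkn'
  set x : ℝ := (k : ℝ) ^ (1 / d) with hx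
  have hx1 : 1 ≤ x := Real.one_le_rpow hk1 (by positivity)
  set Y : ℝ := Real.sqrt n / (k : ℝ) ^ (1 / 2 - 1 / d : ℝ) with hY
  have hYsq : Y ^ 2 = x ^ 2 * n / k := by
    have h1 : (k : ℝ) ^ (1 / 2 - 1 / d : ℝ) = Real.sqrt k / x := by
      rw [Real.rpow_sub hk0, Real.sqrt_eq_rpow]
    rw [hY, h1, div_pow, div_pow, Real.sq_sqrt hn0.le, Real.sq_sqrt hk0.le]
    field_simp
  have hY0 : 0 ≤ Y := by positivity
  have hY1 : 1 ≤ Y := by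
    have h1 : 1 ≤ n / k := (one_le_div hk0).2 hkn'
    have h2 : 1 ≤ Y ^ 2 := by
      rw [hYsq, mul_div_assoc]
      nlinarith
    nlinarith
  -- The least integer with `k ≤ r ^ d`. Since `x ≥ 1`, rounding up costs at most a factor 2, the
  -- source of the 4 in the constant.
  let r : ℕ := ⌈x⌉₊
  have hr1 : 1 ≤ r := Nat.one_le_ceil_iff.2 (by linarith)
  have hxr : x ≤ r := Nat.le_ceil x
  have hr2 : (r : ℝ) ≤ 2 * x := by
    have := Nat.ceil_lt_add_one (by linarith : 0 ≤ x)
    linarith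
  have hkr : (k : ℝ) ≤ (r : ℝ) ^ d := by
    calc (k : ℝ) = x ^ d := by
          rw [hx, ← Real.rpow_mul hk0.le, one_div_mul_cancel hd0.ne', Real.rpow_one]
      _ ≤ _ := Real.rpow_le_rpow (by linarith) hxr hd0.le
  let N : ℕ := ⌈Real.sqrt (3 * (K * 4 + 1)) * Y⌉₊
  have hN1 : Real.sqrt (3 * (K * 4 + 1)) * Y ≤ N := Nat.le_ceil _
  have hN2 : (N : ℝ) ≤ Real.sqrt (3 * (K * 4 + 1)) * Y + 1 :=
    (Nat.ceil_lt_add_one (by positivity)).le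
  have hN : 3 * (K * (r ^ 2 * n / k) + 1) ≤ ((N : ℝ) + 1) ^ 2 := by
    have h1 : (r : ℝ) ^ 2 * n / k ≤ 4 * Y ^ 2 := by
      rw [hYsq]
      calc (r : ℝ) ^ 2 * n / k ≤ (2 * x) ^ 2 * n / k := by gcongr
        _ = _ := by ring
    have h2 : 1 ≤ Y ^ 2 := by nlinarith
    calc _ ≤ 3 * (K * (4 * Y ^ 2) + Y ^ 2) := by gcongr
      _ = (Real.sqrt (3 * (K * 4 + 1)) * Y) ^ 2 := by
          rw [mul_pow, Real.sq_sqrt (by positivity)]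
          ring
      _ ≤ ((N : ℝ) + 1) ^ 2 := by
          refine pow_le_pow_left₀ (by positivity) ?_ 2
          linarith
  have hQ := queryComplexity_le_of_ball hG s hd hκ hball hr1 hk hkr N hN
  calc ((queryComplexity G s (orAtLeast k) : ℕ∞) : ℝ≥0∞)
      ≤ (((4 * (N + 2) : ℕ) : ℕ∞) : ℝ≥0∞) := by exact_mod_cast hQ
    _ = ENNReal.ofReal ((4 * (N + 2) : ℕ) : ℝ) := by
        rw [ENNReal.ofReal_natCast]
        rfl
    _ ≤ _ := by
        refine ENNReal.ofReal_le_ofReal ?_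
        push_cast
        nlinarith

end SpatialSearch

theorem mainTheorem9 {ι : Type*} {V : ι → Type*} [∀ i, Fintype (V i)] [∀ i, DecidableEq (V i)]
    (G : ∀ i, SimpleGraph (V i)) (start : ∀ i, V i) (d : ℝ) (hd : 2 < d)
    (hG : SpatialSearch.IsDimensional d G) :
    ∃ (C : ℝ) (c : ℕ), ∀ (i : ι) (k : ℕ), 1 ≤ k → k ≤ Fintype.card (V i) →
      ((SpatialSearch.queryComplexity (G i) (start i) (SpatialSearch.orAtLeast k) : ℕ∞) : ℝ≥0∞) ≤
        ENNReal.ofReal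
          (C * (Real.sqrt (Fintype.card (V i)) *
              (1 + Real.log ((Fintype.card (V i) : ℝ) / (k : ℝ))) ^ c /
            (k : ℝ) ^ (1 / 2 - 1 / d : ℝ))) := by
  obtain ⟨hconn, κ, hκ, hball⟩ := hG
  obtain ⟨C, hC⟩ := SpatialSearch.exists_queryComplexity_le hd hκ
  -- The exponent 0 suffices: the bound holds without any logarithmic factor.
  refine ⟨C, 0, fun i k hk hkn => ?_⟩
  rw [pow_zero, mul_one]
  exact hC (G i) (start i) k (hconn i) (hball i) hk hkn
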